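/- For a finite simple graph $G=(V,E)$ and $A\subseteq V$ let $I_G(A)$ be the set of edges of $G$ with both endpoints in $A$, let $I_G(m)=\max_{|A|=m}|I_G(A)|$ for $0\le m\le |V|$, and let $\delta_G(m)=I_G(m)-I_G(m-1)$ for $1\le m\le |V|$. A total order on $V$ is called optimal for $G$ if every initial segment $A$ of it satisfies $|I_G(A)|=I_G(|A|)$. Let $G\times G$ denote the Cartesian product, in which $(x,y)$ and $(u,v)$ are adjacent iff either $x=u$ and $yv\in E$, or $y=v$ and $xu\in E$. Let $p\ge 3$, $s\ge 2$ and $1\le i\le p-i$, and let $$\delta=(\{0,1,\dots,p-1\},\{p-i,\dots,p-i+(p-1)\},\dots,\{(s-1)(p-i),\dots,(s-1)(p-i)+(p-1)\})$$ be the sequence of length $sp$ made of the $s$ runs $k(p-i),k(p-i)+1,\dots,k(p-i)+p-1$, $k=0,\dots,s-1$; its entry at position $x\in\{0,\dots,sp-1\}$ is $\delta(x)=\lfloor x/p\rfloor(p-i)+(x\bmod p)$. 1. Let $H$ be any graph on $sp$ vertices whose $\delta$-sequence $(\delta_H(1),\dots,\delta_H(sp))$ equals $\delta$ (that is, $H=H_{s,p,i}$),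 and let its vertex set be ordered by any optimal order for $H$. Then the induced lexicographic order on $V_H\times V_H$ is optimal for $H\times H$. 2. Give the cell $(x,y)$ of the grid $\{0,\dots,sp-1\}^2$ the weight $\delta(x)+\delta(y)$. Then every initial segment of the lexicographic order on the grid is a downset (for the coordinatewise order), and its weight is maximum among all downsets with the same number of cells. This holds whether or not a graph $H$ as in 1 exists. -/

import Mathlib

namespace EdgeIso

/-- The number `|I_G(A)|` of edges of `G` with both endpoints in `A`. -/
noncomputable def inducedEdges {V : Type*} (G : SimpleGraph V) (A : Finset V) : ℕ :=
  {e : Sym2 V | e ∈ G.edgeSet ∧ ∀ v ∈ e, v ∈ A}.ncard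

/-- `I_G(m)`: the maximum of `|I_G(A)|` over all vertex sets `A` with `|A| = m`
(meaningful for `m ≤ |V|`). -/
noncomputable def maxInduced {V : Type*} [Fintype V] (G : SimpleGraph V) (m : ℕ) : ℕ :=
  (Finset.powersetCard m (Finset.univ : Finset V)).sup (inducedEdges G)

/-- `A` is an optimal set: `|I_G(A)| = I_G(|A|)`. -/
def IsOptimalSet {V : Type*} [Fintype V] (G : SimpleGraph V) (A : Finset V) : Prop :=
  inducedEdges G A = maxInduced G A.card

/-- The given total order on the vertices is optimal for `G`: each of its initial segments is an
optimal set. (In a finite total order there is exactly one lower set of each size.) -/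
def IsOptimalOrder {V : Type*} [Fintype V] [LinearOrder V] (G : SimpleGraph V) : Prop :=
  ∀ A : Finset V, IsLowerSet (A : Set V) → IsOptimalSet G A

/-- The entry `δ_G(m) = I_G(m) - I_G(m - 1)` of the `δ`-sequence, for `1 ≤ m ≤ |V|`. -/
noncomputable def delta {V : Type*} [Fintype V] (G : SimpleGraph V) (m : ℕ) : ℤ :=
  (maxInduced G m : ℤ) - (maxInduced G (m - 1) : ℤ)

/-- The entry at position `x`, counted from `0`, of the sequence whose `k`-th run of length `p`
is `k(p-i), k(p-i)+1, …, k(p-i)+p-1`. -/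
def runSeq (p i x : ℕ) : ℕ :=
  (x / p) * (p - i) + x % p

/-- `G` has `sp` vertices and its `δ`-sequence consists of the `s` runs
`k(p-i), …, k(p-i)+p-1`, `k = 0, …, s-1`. -/
def HasRunDeltaSequence {V : Type*} [Fintype V] (G : SimpleGraph V) (s p i : ℕ) : Prop :=
  Fintype.card V = s * p ∧ ∀ x < s * p, delta G (x + 1) = (runSeq p i x : ℤ)

/-- The Cartesian product `G × H`, with its vertex set carrying the lexicographic order. -/
def lexProd {V W : Type*} (G : SimpleGraph V) (H : SimpleGraph W) : SimpleGraph (V ×ₗ W) :=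
  (G.boxProd H).comap ofLex

/-- The weight `w(Z) = ∑ (δ(x) + δ(y))` over `(x, y) ∈ Z`, for a set `Z` of cells of the
`sp × sp` grid. -/
def weight {s p : ℕ} (i : ℕ) (Z : Finset (Fin (s * p) × Fin (s * p))) : ℕ :=
  ∑ z ∈ Z, (runSeq p i z.1 + runSeq p i z.2)

/-- `Z` is a downset of the `sp × sp` grid (in the coordinatewise order), of maximum weight among
all downsets with the same number of cells. -/
def IsMaxWeightDownset {s p : ℕ} (i : ℕ) (Z : Finset (Fin (s * p) × Fin (s * p))) : Prop :=
  IsLowerSet (Z : Set (Fin (s * p) × Fin (s * p))) ∧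
    ∀ B : Finset (Fin (s * p) × Fin (s * p)),
      IsLowerSet (B : Set (Fin (s * p) × Fin (s * p))) → B.card = Z.card → weight i B ≤ weight i Z

end EdgeIso

/-!
Both parts follow from an inequality for the weights of downsets of the grid. The number of edges
that `H × H` induces on a set `A` is the sum of the numbers of edges inside the columns and inside
the rows of `A`. With `S(m)` the sum of the first `m` entries of the `δ`-sequence, a column of size
`a` has at most `S(a)` edges, and replacing each column by an initial segment of the same size does
not decrease the number of edges in the rows. The numbers `w y` of columns of size more than `y`
are the row lengths of a downset of the grid, and `A` has at most as many edges as this downset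
weighs (`sum_adjPairs_row_le`, `sum_runSum_le`, `adjPairs_boxProd_le`). For initial segments of the
lexicographic order equality holds, since all their columns and rows are initial segments.

It remains to be shown that among the downsets of the grid of side `t * p` with `m` cells, the
lexicographic initial segment, of weight `lexWeight k p t m` with `k = p - i`, is the heaviest
(`lexOptimal`). The proof is by induction on the number `t` of runs. A downset in the grid of side
`(t + 1) * p` is cut into its part in the `p × p` grid, the part above that, and the part to the
right of both; all cells above or to the right weigh `k` more than their translates in the grid of
side `t * p`. If the last two parts fit into that smaller grid, the base case and the induction
hypothesis bound the three parts by lexicographic segments (`IsDiagram.cellWeight_le`).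
Transposition and half-turn complementation reduce the general case to this one
(`LexOptimal.succ`).

The sum of the bounds for the three parts may exceed the bound for the whole if a part is too long.
Then the part above can be rearranged so that the first column is full, or the part to the right so
that the first row or the first `p` rows are full; these are removed, and an induction on the
number of cells applies (`cellWeight_le_of_column`, `cellWeight_le_of_row`,
`cellWeight_le_of_rows`). In all other cases three segments can be joined directly
(`lexWeight_join_three_of_lt`, `lexWeight_join_three_of_full`, `lexWeight_join_three_of_le`). This
rests on the superadditivity of the sums `S` and of the weights of lexicographic segments
(`runSum_add_runSum_le`, `lexWeight_superadd`), and on the inequality `lexWeight_join_le` for a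
segment in the `p × p` grid with another one above it.

The induction starts with a single run, where the entries are `0, 1, …, p - 1`. This is also a
sequence of `p` runs of length one with `k = 1`, so that the induction step itself, with these
parameters, proves the base case (`lexOptimal_one`).
-/

namespace RunGrid

open Finset

/-- The sequence of runs, continued to all of `ℕ`: runs `jk, jk + 1, …, jk + p - 1` of length `p`,
with the starting points of consecutive runs `k` apart. -/
def run (k p x : ℕ) : ℤ := (k : ℤ) * (x / p : ℕ) + (x % p : ℕ)

/-- The sum of the first `h` entries of `run k p`. -/
def runSum (k p h : ℕ) : ℤ := ∑ y ∈ range h, run k p y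

/-- The weight of the first `m` cells of the grid with columns of height `t * p`, read column by
column. -/
def lexWeight (k p t m : ℕ) : ℤ :=
  ∑ j ∈ range m, (run k p (j / (t * p)) + run k p (j % (t * p)))

/-- The parameters considered: `k` is the distance between the starting points of consecutive runs
of length `p`, so that consecutive runs overlap in at most half of their length. -/
structure Admissible (k p : ℕ) : Prop where
  one_le : 1 ≤ k
  le : k ≤ p
  le_two_mul : p ≤ 2 * k

theorem Admissible.pos {k p : ℕ} (H : Admissible k p) : 0 < p := H.one_le.trans H.le

/-! ### The run sequence and its partial sums -/

section Run

variable {k p : ℕ}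

theorem run_mul_add (hp : 0 < p) (j x : ℕ) : run k p (p * j + x) = k * j + run k p x := by
  unfold run
  rw [Nat.mul_add_div hp, Nat.mul_add_mod]
  push_cast
  ring

theorem run_of_lt {x : ℕ} (hx : x < p) : run k p x = x := by
  simp [run, Nat.div_eq_of_lt hx, Nat.mod_eq_of_lt hx]

theorem run_nonneg (x : ℕ) : 0 ≤ run k p x := by unfold run; positivity

theorem run_le_self (hkp : k ≤ p) (x : ℕ) : run k p x ≤ x := by
  have h1 : ((p * (x / p) + x % p : ℕ) : ℤ) = x := by rw [Nat.div_add_mod]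
  have h2 : (k : ℤ) * (x / p : ℕ) ≤ p * (x / p : ℕ) := by gcongr
  unfold run
  push_cast at h1 h2 ⊢
  linarith

theorem run_succ_le (H : Admissible k p) (x : ℕ) : run k p (x + 1) ≤ run k p x + 1 := by
  have hp := H.pos
  have hx : x % p < p := Nat.mod_lt _ hp
  obtain ⟨j, b, hb, rfl⟩ : ∃ j b, b < p ∧ x = p * j + b :=
    ⟨x / p, x % p, hx, (Nat.div_add_mod _ _).symm⟩
  rw [add_assoc, run_mul_add hp, run_mul_add hp, run_of_lt hb]
  have := run_le_self H.le (b + 1)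
  push_cast at this
  linarith

theorem runSum_zero : runSum k p 0 = 0 := by simp [runSum]

theorem runSum_succ (h : ℕ) : runSum k p (h + 1) = runSum k p h + run k p h := sum_range_succ _ _

theorem runSum_mul_add (hp : 0 < p) (j y : ℕ) :
    runSum k p (p * j + y) = runSum k p (p * j) + k * j * y + runSum k p y := by
  induction y with
  | zero => simp [runSum_zero]
  | succ y ih =>
    rw [← add_assoc, runSum_succ, ih, run_mul_add hp, runSum_succ]
    push_cast
    ring

theorem two_mul_runSum_of_le {h : ℕ} (hh : h ≤ p) : 2 * runSum k p h = h * (h - 1) := by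
  induction h with
  | zero => simp [runSum_zero]
  | succ h ih =>
    rw [runSum_succ, mul_add, ih (by lia), run_of_lt (by lia)]
    push_cast
    ring

theorem two_mul_runSum_mul (hp : 0 < p) (j : ℕ) :
    2 * runSum k p (p * j) = j * (p * (p - 1)) + p * k * (j * (j - 1)) := by
  induction j with
  | zero => simp [runSum_zero]
  | succ j ih =>
    rw [mul_add_one, runSum_mul_add hp, mul_add, mul_add, ih, two_mul_runSum_of_le le_rfl]
    push_cast
    ring

theorem two_mul_runSum_mul_add (hp : 0 < p) (j : ℕ) {b : ℕ} (hb : b ≤ p) :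
    2 * runSum k p (p * j + b) =
      j * (p * (p - 1)) + p * k * (j * (j - 1)) + 2 * k * j * b + b * (b - 1) := by
  rw [runSum_mul_add hp]
  linear_combination two_mul_runSum_mul (k := k) hp j + two_mul_runSum_of_le (k := k) hb

theorem exists_mul_add (hp : 0 < p) (x : ℕ) : ∃ j b, b < p ∧ x = p * j + b :=
  ⟨x / p, x % p, Nat.mod_lt _ hp, (Nat.div_add_mod _ _).symm⟩

/-- Superadditivity of the partial sums, with an explicit gain. After removal of full runs there are
two cases, with differences `(p - k) * a * b` and `(p - k) * (p - a) * (p - b)`, according to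
whether the remainders `a` and `b` add up to at most `p`. -/
theorem runSum_add_runSum_le (hkp : k ≤ p) (hp : 0 < p) (a b : ℕ) :
    p * (runSum k p a + runSum k p b) + k * (a * b) ≤ p * runSum k p (a + b) := by
  obtain ⟨a1, a2, ha, rfl⟩ := exists_mul_add hp a
  obtain ⟨b1, b2, hb, rfl⟩ := exists_mul_add hp b
  have e1 := two_mul_runSum_mul_add (k := k) hp a1 ha.le
  have e2 := two_mul_runSum_mul_add (k := k) hp b1 hb.le
  have hpk : (0 : ℤ) ≤ p - k := sub_nonneg.2 (by exact_mod_cast hkp)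
  rcases le_total (a2 + b2) p with h | h
  · have e3 := two_mul_runSum_mul_add (k := k) hp (a1 + b1) h
    rw [show p * (a1 + b1) + (a2 + b2) = p * a1 + a2 + (p * b1 + b2) by ring] at e3
    have h0 : (0 : ℤ) ≤ (p - k) * (a2 * b2) := by positivity
    push_cast at e1 e2 e3 ⊢
    have key : 2 * ((p : ℤ) * runSum k p (p * a1 + a2 + (p * b1 + b2))
        - (p * (runSum k p (p * a1 + a2) + runSum k p (p * b1 + b2))
          + k * ((p * a1 + a2) * (p * b1 + b2)))) = 2 * ((p - k) * (a2 * b2)) := by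
      linear_combination p * (e3 - e1 - e2)
    linarith
  · obtain ⟨c, hc⟩ := Nat.exists_eq_add_of_le h
    have e3 := two_mul_runSum_mul_add (k := k) hp (a1 + b1 + 1) (b := c) (by lia)
    rw [show p * (a1 + b1 + 1) + c = p * a1 + a2 + (p * b1 + b2) by
      linear_combination -hc] at e3
    have ha' : (0 : ℤ) ≤ p - a2 := sub_nonneg.2 (by exact_mod_cast ha.le)
    have hb' : (0 : ℤ) ≤ p - b2 := sub_nonneg.2 (by exact_mod_cast hb.le)
    have h0 : (0 : ℤ) ≤ (p - k) * ((p - a2) * (p - b2)) := by positivity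
    push_cast at e1 e2 e3 ⊢
    rw [show (c : ℤ) = a2 + b2 - p by linarith] at e3
    have key : 2 * ((p : ℤ) * runSum k p (p * a1 + a2 + (p * b1 + b2))
        - (p * (runSum k p (p * a1 + a2) + runSum k p (p * b1 + b2))
          + k * ((p * a1 + a2) * (p * b1 + b2)))) = 2 * ((p - k) * ((p - a2) * (p - b2))) := by
      linear_combination p * (e3 - e1 - e2)
    linarith

theorem runSum_superadd (hkp : k ≤ p) (hp : 0 < p) (a b : ℕ) :
    runSum k p a + runSum k p b ≤ runSum k p (a + b) := by
  have h := runSum_add_runSum_le hkp hp a b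
  have h0 : (0 : ℤ) ≤ k * (a * b) := by positivity
  have hp' : (0 : ℤ) < p := by exact_mod_cast hp
  exact le_of_mul_le_mul_left (by linarith) hp'

/-- If a function on `{0, …, M - 1}` is carried to `C` minus itself by reversal, then its sums over
initial segments are determined by those over the complements. -/
theorem sum_range_add_of_reflect {f : ℕ → ℤ} {M : ℕ} {C : ℤ}
    (hf : ∀ j < M, f (M - 1 - j) = C - f j) {a b : ℕ} (hab : a + b = M) :
    ∑ j ∈ range a, f j + b * C = ∑ j ∈ range M, f j + ∑ j ∈ range b, f j := by
  induction b generalizing a with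
  | zero => simp [← hab]
  | succ b ih =>
    have h1 := ih (a := a + 1) (by lia)
    have h2 := hf b (by lia)
    rw [show M - 1 - b = a by lia] at h2
    rw [sum_range_succ] at h1
    rw [sum_range_succ _ b]
    push_cast
    linarith

/-- The sequence is symmetric: reversing the first `t` runs turns each entry into its difference to
the largest one. -/
theorem run_reflect (hp : 0 < p) {t y : ℕ} (hy : y < t * p) :
    run k p (t * p - 1 - y) = ((t - 1) * k + (p - 1)) - run k p y := by
  obtain ⟨j, b, hb, rfl⟩ := exists_mul_add hp y
  have hj : j < t := by
    by_contra hj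
    have : p * t ≤ p * j := Nat.mul_le_mul_left p (by lia)
    lia
  obtain ⟨u, rfl⟩ := Nat.exists_eq_add_of_lt hj
  rw [show (j + u + 1) * p - 1 - (p * j + b) = p * u + (p - 1 - b) by
      have : (j + u + 1) * p = p * j + p * u + p := by ring
      lia, run_mul_add hp, run_mul_add hp, run_of_lt hb,
    run_of_lt (by lia), show p - 1 - b = p - (1 + b) by lia, Nat.cast_sub (by lia)]
  push_cast
  ring

theorem runSum_add_of_add_eq (hp : 0 < p) {t a b : ℕ} (hab : a + b = t * p) :
    runSum k p a + b * ((t - 1) * k + (p - 1)) = runSum k p (t * p) + runSum k p b :=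
  sum_range_add_of_reflect (fun _ hj => run_reflect hp hj) hab

/-- The image of `runSum_add_runSum_le` under the reflection of `t` runs, for two segments that
overfill `t * p` places. -/
theorem runSum_add_runSum_le_of_le (hkp : k ≤ p) (hp : 0 < p) {t a b c : ℕ} (ha : a ≤ t * p)
    (hb : b ≤ t * p) (hc : a + b = t * p + c) :
    p * (runSum k p a + runSum k p b) + k * ((t * p - a) * (t * p - b)) ≤
      p * (runSum k p (t * p) + runSum k p c) := by
  obtain ⟨a', ha'⟩ := Nat.exists_eq_add_of_le ha
  obtain ⟨b', hb'⟩ := Nat.exists_eq_add_of_le hb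
  have h := runSum_add_runSum_le hkp hp a' b'
  have e1 := runSum_add_of_add_eq (k := k) hp ha'.symm
  have e2 := runSum_add_of_add_eq (k := k) hp hb'.symm
  have e3 := runSum_add_of_add_eq (k := k) hp (t := t) (a := c) (b := a' + b') (by lia)
  have e4 : (t * p - a : ℤ) * (t * p - b) = a' * b' := by
    rw [show (t * p - a : ℤ) = a' by linarith, show (t * p - b : ℤ) = b' by linarith]
  rw [e4]
  push_cast at e3
  linear_combination h + p * e1 + p * e2 - p * e3

theorem runSum_add_le_of_le (hkp : k ≤ p) (hp : 0 < p) {t a b c : ℕ} (ha : a ≤ t * p)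
    (hb : b ≤ t * p) (hc : a + b = t * p + c) :
    runSum k p a + runSum k p b ≤ runSum k p (t * p) + runSum k p c := by
  have h := runSum_add_runSum_le_of_le (k := k) hkp hp ha hb hc
  have ha2 : (0 : ℤ) ≤ t * p - a := sub_nonneg.2 (by exact_mod_cast ha)
  have hb2 : (0 : ℤ) ≤ t * p - b := sub_nonneg.2 (by exact_mod_cast hb)
  have h0 : (0 : ℤ) ≤ k * ((t * p - a) * (t * p - b)) := by positivity
  have hp' : (0 : ℤ) < p := by exact_mod_cast hp
  exact le_of_mul_le_mul_left (by linarith) hp'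

/-- The partial sum over one more run. -/
theorem runSum_succ_mul (hp : 0 < p) (t : ℕ) :
    runSum k p ((t + 1) * p) = runSum k p p + k * (t * p) + runSum k p (t * p) := by
  have := runSum_mul_add (k := k) hp 1 (t * p)
  rw [show p * 1 + t * p = (t + 1) * p by ring, mul_one] at this
  rw [this]
  push_cast
  ring

theorem runSum_period_add (hp : 0 < p) (y : ℕ) :
    runSum k p (p + y) = runSum k p p + k * y + runSum k p y := by
  have := runSum_mul_add (k := k) hp 1 y
  rw [mul_one] at this
  rw [this]
  push_cast
  ring

end Run

/-! ### The weights of lexicographic initial segments -/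

section LexWeight

variable {k p t : ℕ}

theorem lexWeight_zero : lexWeight k p t 0 = 0 := by simp [lexWeight]

theorem lexWeight_nonneg (m : ℕ) : 0 ≤ lexWeight k p t m :=
  sum_nonneg fun _ _ => add_nonneg (run_nonneg _) (run_nonneg _)

/-- Full columns, followed by a partial one. -/
theorem lexWeight_mul_add (hT : 0 < t * p) (q : ℕ) {r : ℕ} (hr : r ≤ t * p) :
    lexWeight k p t (t * p * q + r) =
      lexWeight k p t (t * p * q) + run k p q * r + runSum k p r := by
  unfold lexWeight runSum
  rw [sum_range_add, add_assoc]
  congr 1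
  rw [show run k p q * r = ∑ _j ∈ range r, run k p q by simp [mul_comm], ← sum_add_distrib]
  refine sum_congr rfl fun j hj => ?_
  have hj' : j < t * p := (mem_range.1 hj).trans_le hr
  rw [Nat.mul_add_div hT, Nat.mul_add_mod, Nat.div_eq_of_lt hj', Nat.mod_eq_of_lt hj', add_zero]

theorem lexWeight_mul (hT : 0 < t * p) (q : ℕ) :
    lexWeight k p t (t * p * q) = q * runSum k p (t * p) + t * p * runSum k p q := by
  induction q with
  | zero => simp [lexWeight_zero, runSum_zero]
  | succ q ih =>
    rw [mul_add_one, lexWeight_mul_add hT q le_rfl, ih, runSum_succ]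
    push_cast
    ring

theorem lexWeight_of_le (hT : 0 < t * p) {m : ℕ} (hm : m ≤ t * p) :
    lexWeight k p t m = runSum k p m := by
  have := lexWeight_mul_add (k := k) hT 0 hm
  simpa [lexWeight_zero, run] using this

/-- A closed form within the first `p` columns. -/
theorem two_mul_lexWeight (hT : 0 < t * p) {q r : ℕ} (hq : q < p) (hr : r ≤ t * p) :
    2 * lexWeight k p t (t * p * q + r) =
      2 * q * runSum k p (t * p) + t * p * (q * (q - 1)) + 2 * q * r + 2 * runSum k p r := by
  rw [lexWeight_mul_add hT q hr, lexWeight_mul hT, run_of_lt hq]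
  linear_combination (t * p : ℤ) * two_mul_runSum_of_le (k := k) hq.le

/-- Removal of the first column. -/
theorem lexWeight_column_add (hT : 0 < t * p) {m : ℕ} (hm : t * p + m ≤ p * (t * p)) :
    lexWeight k p t (t * p + m) = runSum k p (t * p) + m + lexWeight k p t m := by
  rw [← lexWeight_of_le hT le_rfl]
  unfold lexWeight
  rw [sum_range_add, add_assoc]
  congr 1
  rw [show (m : ℤ) = ∑ _j ∈ range m, 1 by simp, ← sum_add_distrib]
  refine sum_congr rfl fun j hj => ?_
  have hj' : j / (t * p) + 1 < p := by
    have h1 : t * p * (j / (t * p)) ≤ j := Nat.mul_div_le _ _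
    have h2 := mem_range.1 hj
    by_contra hc
    have : p * (t * p) ≤ (j / (t * p) + 1) * (t * p) := Nat.mul_le_mul_right _ (by lia)
    lia
  rw [Nat.add_div_left _ hT, Nat.add_mod_left, run_of_lt hj',
    run_of_lt (x := j / (t * p)) (by lia)]
  push_cast
  ring

/-- Removal of the first `p` columns. -/
theorem lexWeight_strip_add (hp : 0 < p) (hT : 0 < t * p) (m : ℕ) :
    lexWeight k p t (p * (t * p) + m) =
      lexWeight k p t (p * (t * p)) + k * m + lexWeight k p t m := by
  unfold lexWeight
  rw [sum_range_add, add_assoc]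
  congr 1
  rw [show (k * m : ℤ) = ∑ _j ∈ range m, (k : ℤ) by simp [mul_comm], ← sum_add_distrib]
  refine sum_congr rfl fun j _ => ?_
  have h1 := run_mul_add (k := k) hp 1 (j / (t * p))
  rw [mul_comm p (t * p), Nat.mul_add_div hT, Nat.mul_add_mod]
  rw [mul_one] at h1
  rw [h1]
  push_cast
  ring

/-- Complementation inside the first `γ ≤ p` columns. -/
theorem lexWeight_add_of_add_eq (hp : 0 < p) {γ a b : ℕ} (hγ : γ ≤ p) (hab : a + b = t * p * γ) :
    lexWeight k p t a + b * ((γ - 1) + ((t - 1) * k + (p - 1))) =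
      lexWeight k p t (t * p * γ) + lexWeight k p t b := by
  refine sum_range_add_of_reflect (fun j hj => ?_) hab
  have hT : 0 < t * p := Nat.pos_of_mul_pos_right (Nat.zero_lt_of_lt hj)
  obtain ⟨q, r, hr, rfl⟩ := exists_mul_add hT j
  have hq : q < γ := by
    by_contra hq
    have : t * p * γ ≤ t * p * q := Nat.mul_le_mul_left _ (by lia)
    lia
  obtain ⟨u, rfl⟩ := Nat.exists_eq_add_of_lt hq
  rw [show t * p * (q + u + 1) - 1 - (t * p * q + r) = t * p * u + (t * p - 1 - r) by
      have : t * p * (q + u + 1) = t * p * q + t * p * u + t * p := by ring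
      lia, Nat.mul_add_div hT, Nat.mul_add_mod, Nat.mul_add_div hT, Nat.mul_add_mod,
    Nat.div_eq_of_lt hr, Nat.mod_eq_of_lt hr, Nat.div_eq_of_lt (a := t * p - 1 - r) (by lia),
    Nat.mod_eq_of_lt (a := t * p - 1 - r) (by lia), run_reflect hp hr,
    run_of_lt (x := q + 0) (by lia), run_of_lt (x := u + 0) (by lia)]
  push_cast
  ring

/-- Complementation in the whole grid. -/
theorem lexWeight_add_of_add_eq_sq (hp : 0 < p) {a b : ℕ} (hab : a + b = t * p * (t * p)) :
    lexWeight k p t a + b * (2 * ((t - 1) * k + (p - 1))) =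
      lexWeight k p t (t * p * (t * p)) + lexWeight k p t b := by
  refine sum_range_add_of_reflect (fun j hj => ?_) hab
  have hT : 0 < t * p := Nat.pos_of_mul_pos_right (Nat.zero_lt_of_lt hj)
  obtain ⟨q, r, hr, rfl⟩ := exists_mul_add hT j
  have hq : q < t * p := Nat.lt_of_mul_lt_mul_left (a := t * p) (by lia)
  rw [show t * p * (t * p) - 1 - (t * p * q + r) =
      t * p * (t * p - 1 - q) + (t * p - 1 - r) by
      obtain ⟨u, hu⟩ := Nat.exists_eq_add_of_lt hq
      have : t * p * (t * p) = t * p * q + t * p * u + t * p := by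
        nth_rw 2 [hu]
        ring
      rw [show t * p - 1 - q = u by lia]
      lia, Nat.mul_add_div hT, Nat.mul_add_mod, Nat.mul_add_div hT, Nat.mul_add_mod,
    Nat.div_eq_of_lt hr, Nat.mod_eq_of_lt hr, Nat.div_eq_of_lt (a := t * p - 1 - r) (by lia),
    Nat.mod_eq_of_lt (a := t * p - 1 - r) (by lia), run_reflect hp hr, add_zero, add_zero,
    run_reflect hp hq]
  ring

/-- Superadditivity within the first `p` columns: full columns can be removed from both segments,
and for segments shorter than a column this follows from the two bounds for `runSum`. -/
theorem lexWeight_superadd (hkp : k ≤ p) (hp : 0 < p) (ht : 0 < t) {a b : ℕ}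
    (hab : a + b ≤ p * (t * p)) :
    lexWeight k p t a + lexWeight k p t b ≤ lexWeight k p t (a + b) := by
  have hT : 0 < t * p := Nat.mul_pos ht hp
  induction hm : a + b using Nat.strong_induction_on generalizing a b with
  | _ m ih =>
    subst hm
    by_cases ha : t * p ≤ a
    · obtain ⟨a, rfl⟩ := Nat.exists_eq_add_of_le ha
      have h := ih (a + b) (by lia) (a := a) (b := b) (by lia) rfl
      rw [lexWeight_column_add hT (by lia), add_assoc (t * p) a b,
        lexWeight_column_add hT (m := a + b) (by lia)]
      push_cast
      linarith
    by_cases hb : t * p ≤ b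
    · obtain ⟨b, rfl⟩ := Nat.exists_eq_add_of_le hb
      have h := ih (a + b) (by lia) (a := a) (b := b) (by lia) rfl
      rw [lexWeight_column_add hT (by lia), show a + (t * p + b) = t * p + (a + b) by ring,
        lexWeight_column_add hT (by lia)]
      push_cast
      linarith
    push Not at ha hb
    rw [lexWeight_of_le hT ha.le, lexWeight_of_le hT hb.le]
    rcases le_total (a + b) (t * p) with h | h
    · rw [lexWeight_of_le hT h]
      exact runSum_superadd hkp hp a b
    · obtain ⟨c, hc⟩ := Nat.exists_eq_add_of_le h
      rw [hc, lexWeight_column_add hT (by lia), lexWeight_of_le hT (by lia)]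
      have := runSum_add_le_of_le (k := k) hkp hp ha.le hb.le hc
      linarith [Nat.cast_nonneg (α := ℤ) c]

/-- A lexicographic initial segment contained in the first `p` columns consists of one in the
`p × p` grid and one in the columns of height `t * p` above that grid, whose cells weigh `k` more
than the corresponding cells at the bottom. -/
theorem lexWeight_split (hp : 0 < p) (ht : 0 < t) {q r : ℕ}
    (hqr : q < p ∧ r ≤ (t + 1) * p ∨ q = p ∧ r = 0) :
    lexWeight k p (t + 1) ((t + 1) * p * q + r) =
      lexWeight k p 1 (p * q + min r p) + k * (t * p * q + (r - p) : ℕ) +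
        lexWeight k p t (t * p * q + (r - p)) := by
  have hT : 0 < t * p := Nat.mul_pos ht hp
  have hT1 : 0 < (t + 1) * p := Nat.mul_pos t.succ_pos hp
  have hp1 : 0 < 1 * p := by lia
  have e1 := runSum_succ_mul (k := k) hp t
  rcases hqr with ⟨hq, hr⟩ | ⟨rfl, rfl⟩
  · have f1 := two_mul_lexWeight (k := k) hT1 hq hr
    have hr' : r - p ≤ t * p := by rw [add_one_mul] at hr; lia
    have f2 := two_mul_lexWeight (k := k) hT hq hr'
    have f3 := two_mul_lexWeight (k := k) (t := 1) (r := min r p) (by lia) hq (by lia)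
    rw [one_mul] at f3
    have e2 : runSum k p r = runSum k p (min r p) + k * (r - p : ℕ) + runSum k p (r - p) := by
      rcases le_total r p with h | h
      · simp [h, runSum_zero]
      · obtain ⟨c, rfl⟩ := Nat.exists_eq_add_of_le h
        rw [runSum_period_add hp]
        simp
    have e3 : (r : ℤ) = (min r p : ℕ) + (r - p : ℕ) := by exact_mod_cast (by lia)
    rw [e1, e2, e3] at f1
    push_cast at f1 f2 f3 ⊢
    linarith
  · have f1 := lexWeight_mul (k := k) hT1 q
    have f2 := lexWeight_mul (k := k) hT q
    have f3 := lexWeight_mul (k := k) hp1 q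
    rw [one_mul] at f3
    rw [e1] at f1
    simp only [add_zero, Nat.zero_sub, Nat.zero_min]
    push_cast at f1 f2 f3 ⊢
    linear_combination f1 - f2 - f3

end LexWeight

/-! ### Joining two lexicographic segments -/

section Join

variable {k p t : ℕ}

set_option maxHeartbeats 800000 in
/-- The instance `t = 1` of `lexWeight_join_le` with less than a full column in the second segment.
In each of four cases, `p` times the difference of the two sides is a sum of two products of
nonnegative factors. -/
theorem lexWeight_join_one_of_lt (H : Admissible k p) {c u : ℕ} (hc : c ≤ p * p) (hu : u < p)
    (huc : 0 < u → p ≤ c) :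
    lexWeight k p 1 c + k * u + runSum k p u ≤ lexWeight k p 2 (c + u) := by
  have hp := H.pos
  have h1p : 0 < 1 * p := by lia
  have h2p : 0 < 2 * p := by lia
  have e0 := two_mul_runSum_of_le (k := k) (p := p) le_rfl
  have e1 := two_mul_runSum_of_le (k := k) hu.le
  have e2 : 2 * runSum k p (2 * p) = 2 * (p * (p - 1)) + 2 * k * p := by
    have := runSum_succ_mul (k := k) hp 1
    rw [one_mul] at this
    push_cast at this
    linear_combination 2 * this + 2 * e0
  have hpk : (p : ℤ) ≤ 2 * k := by exact_mod_cast H.le_two_mul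
  have hp1 : (1 : ℤ) ≤ p := by linarith
  obtain ⟨q, b, hb, rfl⟩ := exists_mul_add hp c
  have hq : q ≤ p := Nat.le_of_mul_le_mul_left (show p * q ≤ p * p by lia) hp
  have hqb : 0 < b → q < p := by
    intro hb0
    by_contra hqp
    have : p * p ≤ p * q := Nat.mul_le_mul_left _ (by lia)
    lia
  have f1 : 2 * lexWeight k p 1 (p * q + b) =
      q * (p * (p - 1)) + p * (q * (q - 1)) + 2 * q * b + b * (b - 1) := by
    have g1 := two_mul_runSum_of_le (k := k) hb.le
    have g2 := lexWeight_mul_add (k := k) h1p q (r := b) (by lia)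
    have g3 := lexWeight_mul (k := k) h1p q
    have g4 := two_mul_runSum_of_le (k := k) hq
    have g5 : run k p q * b = q * b := by
      rcases Nat.eq_zero_or_pos b with rfl | h
      · simp
      · rw [run_of_lt (hqb h)]
    rw [one_mul] at g2 g3
    push_cast at g3
    linear_combination 2 * g2 + 2 * g3 + 2 * g5 + g1 + p * g4 + q * e0
  -- four cases, according to the parity of `q` and to whether the last column overflows
  suffices 0 ≤ 2 * p * (lexWeight k p 2 (p * q + b + u)
      - (lexWeight k p 1 (p * q + b) + k * u + runSum k p u)) by
    have h := nonneg_of_mul_nonneg_right this (by linarith)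
    linarith
  obtain ⟨a, rfl | rfl⟩ : ∃ a, q = 2 * a ∨ q = 2 * a + 1 := ⟨q / 2, by lia⟩
  · have ha0 : (0 : ℤ) ≤ a := by positivity
    have ha1 : 0 < u → (1 : ℤ) ≤ a := by
      intro h
      by_contra hc
      obtain rfl : a = 0 := by lia
      lia
    have hak : (a : ℤ) ≤ k := by exact_mod_cast (by lia : a ≤ k)
    have hak1 : 0 < b → (a : ℤ) + 1 ≤ k := by
      intro h
      have := hqb h
      lia
    rcases le_total (b + u) p with h | h
    · have f2 := two_mul_lexWeight (k := k) h2p (q := a) (r := b + u) (by lia) (by lia)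
      have g := two_mul_runSum_of_le (k := k) h
      have n1 : (0 : ℤ) ≤ a * p - u := by
        rcases Nat.eq_zero_or_pos u with rfl | h
        · simpa using by positivity
        · nlinarith [ha1 h]
      have n2 : (0 : ℤ) ≤ (k - a) * p - b := by
        rcases Nat.eq_zero_or_pos b with rfl | h
        · have : (0 : ℤ) ≤ k - a := by linarith
          simpa using by positivity
        · nlinarith [hak1 h]
      have n3 : 0 ≤ (a * p - u) * ((k - a) * p - b) + (p - 1) * (b * u : ℤ) := by
        have : (0 : ℤ) ≤ p - 1 := by linarith
        positivity
      rw [show p * (2 * a) + b + u = 2 * p * a + (b + u) by ring] at *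
      push_cast at f1 f2 g ⊢
      linear_combination 2 * n3 + p * (f1 + e1 - f2 - a * e2 - g)
    · obtain ⟨d, hd⟩ := Nat.exists_eq_add_of_le h
      have f2 := two_mul_lexWeight (k := k) h2p (q := a) (r := b + u) (by lia) (by lia)
      have g1 := two_mul_runSum_of_le (k := k) (p := p) (h := d) (by lia)
      have g2 := runSum_period_add (k := k) hp d
      have hd' : (d : ℤ) = b + u - p := by
        have : (b : ℤ) + u = p + d := by exact_mod_cast hd
        linarith
      rw [← hd] at g2
      rw [hd'] at g1 g2
      have n1 : (0 : ℤ) ≤ (a - 1) * p + b := by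
        have : (0 : ℤ) ≤ a - 1 := by linarith [ha1 (by lia)]
        positivity
      have n2 : (0 : ℤ) ≤ (k - a - 1) * p + u := by
        have : (0 : ℤ) ≤ k - a - 1 := by linarith [hak1 (by lia)]
        positivity
      have n3 : 0 ≤ ((a - 1) * p + b) * ((k - a - 1) * p + u)
          + (p - 1) * ((p - b) * (p - u) : ℤ) := by
        have : (0 : ℤ) ≤ p - 1 := by linarith
        have : (0 : ℤ) ≤ p - b := by linarith
        have : (0 : ℤ) ≤ p - u := by linarith
        positivity
      rw [show p * (2 * a) + b + u = 2 * p * a + (b + u) by ring] at *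
      push_cast at f1 f2 g1 g2 ⊢
      linear_combination 2 * n3 + p * (f1 + e1 - f2 - a * e2 - g1 - 2 * g2 - e0)
  · have ha0 : (0 : ℤ) ≤ a := by positivity
    have hak : (a : ℤ) + 1 ≤ k := by exact_mod_cast (by lia : a + 1 ≤ k)
    rcases le_total (b + u) p with h | h
    · have f2 := two_mul_lexWeight (k := k) h2p (q := a) (r := p + (b + u)) (by lia) (by lia)
      have g1 := two_mul_runSum_of_le (k := k) h
      have g2 := runSum_period_add (k := k) hp (b + u)
      have n3 : 0 ≤ (a * p + b) * ((k - a - 1) * p + u) + (p - 1) * (b * u : ℤ) := by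
        have : (0 : ℤ) ≤ p - 1 := by linarith
        have : (0 : ℤ) ≤ k - a - 1 := by linarith
        positivity
      rw [show p * (2 * a + 1) + b + u = 2 * p * a + (p + (b + u)) by ring] at *
      push_cast at f1 f2 g1 g2 ⊢
      linear_combination 2 * n3 + p * (f1 + e1 - f2 - a * e2 - g1 - 2 * g2 - e0)
    · obtain ⟨d, hd⟩ := Nat.exists_eq_add_of_le h
      have hqb' := hqb (by lia)
      have f2 := two_mul_lexWeight (k := k) h2p (q := a + 1) (r := d) (by lia) (by lia)
      have g1 := two_mul_runSum_of_le (k := k) (p := p) (h := d) (by lia)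
      rw [show 2 * p * (a + 1) + d = p * (2 * a + 1) + b + u by linear_combination -hd] at f2
      have hd' : (d : ℤ) = b + u - p := by
        have : (b : ℤ) + u = p + d := by exact_mod_cast hd
        linarith
      push_cast at f1 f2 g1 ⊢
      rw [hd'] at g1 f2
      have n1 : (0 : ℤ) ≤ (a + 1) * p - u := by nlinarith
      have n2 : (0 : ℤ) ≤ (k - a) * p - b := by nlinarith
      have n3 : 0 ≤ ((a + 1) * p - u) * ((k - a) * p - b)
          + (p - 1) * ((p - b) * (p - u) : ℤ) := by
        have : (0 : ℤ) ≤ p - 1 := by linarith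
        have : (0 : ℤ) ≤ p - b := by linarith
        have : (0 : ℤ) ≤ p - u := by linarith
        positivity
      linear_combination 2 * n3 + p * (f1 + e1 - f2 - (a + 1) * e2 - g1)

/-- The lexicographic initial segment of `c + σ` cells in `t + 1` runs weighs at least as much as
the segment of `c` cells in the `p × p` grid together with the segment of `σ` cells in the columns
of height `t * p` placed above that grid, provided that the second segment uses no more columns
than the first one fills. -/
def JoinAbove (k p t m : ℕ) : Prop :=
  ∀ c a σ, c + σ = m → p * a ≤ c → c ≤ p * p → σ ≤ a * (t * p) →
    lexWeight k p 1 c + k * σ + lexWeight k p t σ ≤ lexWeight k p (t + 1) m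

/-- The lexicographic initial segment of `c + x` cells in `t + 1` runs weighs at least as much as
the segment of `c` cells in `t` runs together with `x ≤ p` cells on top of its first column, which
has to be full if `x` is positive. -/
def JoinTop (k p t m : ℕ) : Prop :=
  ∀ c x, c + x = m → c ≤ p * (t * p) → x ≤ p → (0 < x → t * p ≤ c) →
    lexWeight k p t c + t * k * x + runSum k p x ≤ lexWeight k p (t + 1) m

/-- Removal of a full column from both segments. -/
theorem JoinAbove.step (hp : 0 < p) (ht : 0 < t) {c a σ : ℕ} (ha : p * a ≤ c) (hc : c ≤ p * p)
    (hσ : σ ≤ a * (t * p)) (hσt : t * p ≤ σ) (ih : JoinAbove k p t (c + σ - (t + 1) * p)) :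
    lexWeight k p 1 c + k * σ + lexWeight k p t σ ≤ lexWeight k p (t + 1) (c + σ) := by
  have hT : 0 < t * p := Nat.mul_pos ht hp
  obtain ⟨a, rfl⟩ : ∃ b, a = b + 1 := by
    refine Nat.exists_eq_succ_of_ne_zero ?_
    rintro rfl
    lia
  obtain ⟨σ, rfl⟩ := Nat.exists_eq_add_of_le hσt
  obtain ⟨c, rfl⟩ := Nat.exists_eq_add_of_le (show p ≤ c by rw [mul_add_one] at ha; lia)
  have hap : a < p := Nat.lt_of_mul_lt_mul_left (a := p) (by rw [mul_add_one] at ha; lia)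
  have hle : t * p + σ ≤ p * (t * p) := hσ.trans (Nat.mul_le_mul_right _ hap)
  have hle1 : (t + 1) * p + (c + σ) ≤ p * ((t + 1) * p) := by
    have : p * ((t + 1) * p) = p * (t * p) + p * p := by ring
    lia
  rw [show p + c + (t * p + σ) - (t + 1) * p = c + σ by lia] at ih
  have h := ih c a σ rfl (by rw [mul_add_one] at ha; lia) (by lia)
    (by rw [add_one_mul] at hσ; lia)
  have f1 := lexWeight_column_add (k := k) (t := t) hT hle
  have f2 := lexWeight_column_add (k := k) (p := p) (t := 1) (m := c) (by lia) (by lia)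
  have f3 := lexWeight_column_add (k := k) (Nat.mul_pos t.succ_pos hp) hle1
  have f4 := runSum_succ_mul (k := k) hp t
  rw [one_mul] at f2
  rw [show p + c + (t * p + σ) = (t + 1) * p + (c + σ) by lia, f1, f2, f3, f4]
  push_cast
  linarith

theorem joinAbove_one (H : Admissible k p) (m : ℕ) : JoinAbove k p 1 m := by
  have hp := H.pos
  induction m using Nat.strong_induction_on with
  | _ m ih =>
    intro c a σ hm ha hc hσ
    rw [one_mul] at hσ
    rcases lt_or_ge σ p with h | h
    · subst hm
      rw [lexWeight_of_le (t := 1) (m := σ) (by lia) (by lia)]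
      refine lexWeight_join_one_of_lt H hc h fun h0 => le_trans ?_ ha
      exact Nat.le_mul_of_pos_right p (Nat.pos_of_mul_pos_right (h0.trans_le hσ))
    · subst hm
      exact JoinAbove.step hp one_pos ha hc (by lia) (by lia) (ih _ (by lia))

theorem joinTop_one (H : Admissible k p) (m : ℕ) : JoinTop k p 1 m := by
  intro c x hm hc hx hxc
  have hp := H.pos
  have := joinAbove_one H m c (if 0 < x then 1 else 0) x hm (by split_ifs <;> lia) (by lia)
    (by split_ifs <;> lia)
  rw [lexWeight_of_le (t := 1) (m := x) (by lia) (by lia)] at this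
  simpa using this

/-- The segment of `c` cells is split by `lexWeight_split`. The `x` further cells are added to its
upper part with one run fewer, and the result is joined to its lower part. If the upper part then
contains no full column, there is so little of it that the two sides can be compared directly. -/
theorem joinTop_succ (H : Admissible k p) (ht : 0 < t) {m : ℕ}
    (hA : ∀ m' < m, JoinAbove k p (t + 1) m') (hB : ∀ m', JoinTop k p t m') :
    JoinTop k p (t + 1) m := by
  intro c x hm hc hx hxc
  have hp := H.pos
  have hN : 0 < (t + 1) * p := Nat.mul_pos t.succ_pos hp
  have hn : 0 < (t + 1 + 1) * p := Nat.mul_pos (t + 1).succ_pos hp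
  have hpT : p ≤ t * p := Nat.le_mul_of_pos_left p ht
  obtain ⟨q, r, hr, rfl⟩ := exists_mul_add hN c
  have hq : q ≤ p := by
    refine Nat.le_of_mul_le_mul_left (show (t + 1) * p * q ≤ (t + 1) * p * p from ?_) hN
    rw [mul_comm p] at hc
    lia
  have hqr : q < p ∧ r ≤ (t + 1) * p ∨ q = p ∧ r = 0 := by
    rcases hq.lt_or_eq with h | rfl
    · exact Or.inl ⟨h, hr.le⟩
    · rw [mul_comm q] at hc
      exact Or.inr ⟨rfl, by lia⟩
  have hq0 : 0 < x → 0 < q := by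
    intro h
    have := hxc h
    by_contra hq
    obtain rfl : q = 0 := by lia
    lia
  have esplit := lexWeight_split (k := k) hp ht hqr
  have hm' : p * q + min r p + (t * p * q + (r - p) + x) = (t + 1) * p * q + r + x := by
    have : (t + 1) * p * q = p * q + t * p * q := by ring
    lia
  have hB' := hB _ (t * p * q + (r - p)) x rfl (by
      rcases hqr with ⟨h1, h2⟩ | ⟨rfl, rfl⟩
      · have : t * p * (q + 1) ≤ t * p * p := Nat.mul_le_mul_left _ h1
        rw [mul_add_one] at this
        rw [mul_comm p]
        lia
      · simp [mul_comm]) hx (fun h => by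
      have : t * p ≤ t * p * q := Nat.le_mul_of_pos_right _ (hq0 h)
      lia)
  subst hm
  set u := t * p * q + (r - p) with hu
  rcases le_or_gt ((t + 1) * p) (u + x) with hlarge | hsmall
  · -- the upper segment contains a full column
    have hA' := JoinAbove.step (k := k) (t := t + 1) (c := p * q + min r p)
      (a := if p ≤ r then q + 1 else q) (σ := u + x) hp t.succ_pos
      (by split_ifs <;> [rw [mul_add_one]; skip] <;> lia)
      (by rcases hqr with ⟨h1, h2⟩ | ⟨rfl, rfl⟩
          · have : p * (q + 1) ≤ p * p := Nat.mul_le_mul_left _ h1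
            rw [mul_add_one] at this
            lia
          · simp)
      (by have e1 : (q + 1) * ((t + 1) * p) = t * p * q + p * q + t * p + p := by ring
          have e2 : q * ((t + 1) * p) = t * p * q + p * q := by ring
          have e3 : 0 < x → p ≤ p * q := fun h => Nat.le_mul_of_pos_right _ (hq0 h)
          split_ifs <;> lia)
      hlarge (hA _ (by lia))
    rw [hm'] at hA'
    push_cast at hA' hB' ⊢
    linarith
  · -- the lower segment ends in its first two columns
    obtain rfl | rfl | hq2 : q = 0 ∨ q = 1 ∨ 2 ≤ q := by lia
    · obtain rfl : x = 0 := by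
        by_contra h
        have := hq0 (by lia)
        lia
      simp only [mul_zero, zero_add, add_zero, runSum_zero, Nat.cast_zero]
      rw [lexWeight_of_le hN hr.le, lexWeight_of_le hn (by lia)]
    · clear esplit hB'
      rw [mul_one] at *
      have hrx : r + x < 2 * p := by lia
      have hle : (t + 1) * p + r ≤ p * ((t + 1) * p) := by
        rcases hqr with ⟨h1, h2⟩ | ⟨rfl, rfl⟩
        · have : 2 * ((t + 1) * p) ≤ p * ((t + 1) * p) := Nat.mul_le_mul_right _ h1
          lia
        · lia
      have f1 := lexWeight_column_add (k := k) hN hle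
      rw [lexWeight_of_le hN hr.le] at f1
      have hk1 : (1 : ℤ) ≤ k := by exact_mod_cast H.one_le
      rcases le_or_gt (r + x) p with h | h
      · have f2 := runSum_mul_add (k := k) hp (t + 1) (r + x)
        have f3 := runSum_superadd (k := k) H.le hp r x
        rw [mul_comm p] at f2
        rw [show (t + 1) * p + r + x = (t + 1) * p + (r + x) by lia, lexWeight_of_le hn (by lia),
          f1, f2]
        have h1 : (r : ℤ) ≤ (t + 1) * k * r :=
          le_mul_of_one_le_left (by positivity) (by nlinarith)
        push_cast
        linarith
      · obtain ⟨d, hd⟩ := Nat.exists_eq_add_of_lt h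
        have hp2 : 2 ≤ p := by
          rcases hqr with ⟨h1, h2⟩ | ⟨rfl, rfl⟩ <;> lia
        have hle2 : (t + 1 + 1) * p + (d + 1) ≤ p * ((t + 1 + 1) * p) := by
          have : 2 * ((t + 1 + 1) * p) ≤ p * ((t + 1 + 1) * p) := Nat.mul_le_mul_right _ hp2
          lia
        have f2 := lexWeight_column_add (k := k) hn hle2
        rw [lexWeight_of_le hn (m := d + 1) (by lia)] at f2
        have f3 := runSum_mul_add (k := k) hp (t + 1) x
        rw [mul_comm p] at f3
        have f4 := runSum_add_runSum_le_of_le (k := k) H.le hp (t := t + 1 + 1)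
          (a := (t + 1) * p + x) (b := r) (c := d + 1) (by lia) (by lia) (by lia)
        rw [show (t + 1) * p + r + x = (t + 1 + 1) * p + (d + 1) by lia, f1, f2]
        have e1 : (r : ℤ) + x = p + d + 1 := by exact_mod_cast hd
        have e2 : (p : ℤ) ≤ (t + 1 + 1) * p - r := by
          have : ((p + r : ℕ) : ℤ) ≤ ((t + 1 + 1) * p : ℕ) := by exact_mod_cast (by lia)
          push_cast at this
          linarith
        have e3 : (0 : ℤ) ≤ p - x := by
          have : (x : ℤ) ≤ p := by exact_mod_cast hx
          linarith
        have hp0 : (0 : ℤ) < p := by exact_mod_cast hp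
        have e4 : (p - x) * (p : ℤ) ≤ k * ((p - x) * ((t + 1 + 1) * p - r)) := by
          have : (p - x) * (p : ℤ) ≤ (p - x) * ((t + 1 + 1) * p - r) :=
            mul_le_mul_of_nonneg_left e2 e3
          exact this.trans (le_mul_of_one_le_left (by nlinarith) hk1)
        push_cast at f1 f2 f3 f4 ⊢
        refine le_of_mul_le_mul_left (a := (p : ℤ)) ?_ hp0
        linear_combination f4 - p * f3 + e4 + p * e1
    · have : t * p * 2 ≤ t * p * q := Nat.mul_le_mul_left _ hq2
      lia

/-- A full column of the upper segment can be removed. An upper segment within one column is added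
in two steps: its first `t * p` cells with one run fewer, then the rest on top of the first
column. -/
theorem joinAbove_succ (H : Admissible k p) (ht : 0 < t) {m : ℕ}
    (hA : ∀ m' < m, JoinAbove k p (t + 1) m') (hA' : ∀ m', JoinAbove k p t m')
    (hB : JoinTop k p (t + 1) m) : JoinAbove k p (t + 1) m := by
  intro c a σ hm ha hc hσ
  have hp := H.pos
  have hT : 0 < t * p := Nat.mul_pos ht hp
  have hN : 0 < (t + 1) * p := Nat.mul_pos t.succ_pos hp
  rcases le_or_gt ((t + 1) * p) σ with hlarge | hsmall
  · subst hm
    exact JoinAbove.step hp t.succ_pos ha hc hσ hlarge (hA _ (by lia))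
  have ha0 : 0 < σ → 0 < a := fun h => Nat.pos_of_mul_pos_right (h.trans_le hσ)
  have hpc : 0 < σ → p ≤ c := fun h => (Nat.le_mul_of_pos_right _ (ha0 h)).trans ha
  set u := min σ (t * p) with hu
  obtain ⟨x, hx⟩ := Nat.exists_eq_add_of_le (min_le_left σ (t * p))
  rw [← hu] at hx
  have h1 := hA' _ c a u rfl ha hc (by
    rcases Nat.eq_zero_or_pos σ with h | h
    · lia
    · have := Nat.le_mul_of_pos_left (t * p) (ha0 h)
      lia)
  have h2 := hB (c + u) x (by lia) (by
    have : t * p * 1 ≤ t * p * p := Nat.mul_le_mul_left _ hp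
    have e : p * ((t + 1) * p) = p * p + t * p * p := by ring
    lia) (by lia) (fun h => by have := hpc (by lia); lia)
  have h3 : runSum k p σ = runSum k p u + t * k * x + runSum k p x := by
    rcases Nat.eq_zero_or_pos x with rfl | h
    · simp [hx, runSum_zero]
    · have := runSum_mul_add (k := k) hp t x
      rw [mul_comm p, show t * p = u by lia] at this
      rw [hx, this]
      ring
  rw [lexWeight_of_le hT (by lia)] at h1
  rw [lexWeight_of_le hN hsmall.le, h3, hx]
  push_cast at h2 ⊢
  linarith

theorem join (H : Admissible k p) (ht : 0 < t) (m : ℕ) :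
    JoinAbove k p t m ∧ JoinTop k p t m := by
  induction t, ht using Nat.le_induction generalizing m with
  | base => exact ⟨joinAbove_one H m, joinTop_one H m⟩
  | succ t ht iht =>
    induction m using Nat.strong_induction_on with
    | _ m ih =>
      have hB := joinTop_succ H ht (fun m' hm => (ih m' hm).1) fun m' => (iht m').2
      exact ⟨joinAbove_succ H ht (fun m' hm => (ih m' hm).1) (fun m' => (iht m').1) hB, hB⟩

/-- The inequality `JoinAbove`, which holds for segments of all sizes. -/
theorem lexWeight_join_le (H : Admissible k p) (ht : 0 < t) {c a σ : ℕ} (ha : p * a ≤ c)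
    (hc : c ≤ p * p) (hσ : σ ≤ a * (t * p)) :
    lexWeight k p 1 c + k * σ + lexWeight k p t σ ≤ lexWeight k p (t + 1) (c + σ) :=
  (join H ht _).1 c a σ rfl ha hc hσ

/-- Within the first `p` columns, higher columns give a larger weight. -/
theorem lexWeight_le_succ (H : Admissible k p) (ht : 0 < t) {m : ℕ} (hm : m ≤ p * (t * p)) :
    lexWeight k p t m ≤ lexWeight k p (t + 1) m := by
  simpa [runSum_zero] using (join H ht _).2 m 0 rfl hm (by lia) (by simp)

theorem lexWeight_one_le (H : Admissible k p) (ht : 0 < t) {m : ℕ} (hm : m ≤ p * p) :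
    lexWeight k p 1 m ≤ lexWeight k p t m := by
  induction t, ht using Nat.le_induction with
  | base => rfl
  | succ t ht ih =>
    exact ih.trans (lexWeight_le_succ H ht (hm.trans
      (Nat.mul_le_mul_left _ (Nat.le_mul_of_pos_left p ht))))

end Join

/-! ### Joining three lexicographic segments -/

section JoinThree

variable {k p t : ℕ}

theorem lexWeight_one_full (hp : 0 < p) : lexWeight k p 1 (p * p) = 2 * p * runSum k p p := by
  have f := lexWeight_mul (k := k) (p := p) (t := 1) (by lia) p
  rw [one_mul] at f
  rw [f]
  push_cast
  ring

/-- A segment of `c` cells in the `p × p` grid and two segments that are both shorter than a column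
of height `t * p`. The latter two merge into one column or, if they are too long for that, into a
full column and a rest. -/
theorem lexWeight_join_three_of_lt (H : Admissible k p) (ht : 0 < t) {c u v : ℕ}
    (hc : c ≤ p * p) (hu : u < t * p) (hv : v < t * p) (hcu : 0 < u → p ≤ c)
    (hcv : 0 < v → p ≤ c) (hcuv : 0 < u → 0 < v → 2 * p ≤ c + 1)
    (hm : c + u + v ≤ p * ((t + 1) * p)) :
    lexWeight k p 1 c + k * u + lexWeight k p t u + k * v + lexWeight k p t v ≤
      lexWeight k p (t + 1) (c + u + v) := by
  have hp := H.pos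
  have hT : 0 < t * p := Nat.mul_pos ht hp
  have hn : 0 < (t + 1) * p := Nat.mul_pos t.succ_pos hp
  rw [lexWeight_of_le hT hu.le, lexWeight_of_le hT hv.le]
  rcases le_or_gt (u + v) (t * p) with h | h
  · have h1 := runSum_superadd (k := k) H.le hp u v
    have h2 := lexWeight_join_le (c := c) (a := if 0 < u + v then 1 else 0) (σ := u + v) H ht
      (by split_ifs <;> lia) hc (by split_ifs <;> lia)
    rw [lexWeight_of_le hT h, ← add_assoc] at h2
    push_cast at h2
    linarith
  · -- `w` cells are left over when the second and the third segment have filled one column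
    obtain ⟨w, hw⟩ := Nat.exists_eq_add_of_le h.le
    have h2p := hcuv (by lia) (by lia)
    obtain ⟨c, rfl⟩ := Nat.exists_eq_add_of_le (hcu (by lia))
    have hle : (t + 1) * p + (c + w) ≤ p * ((t + 1) * p) := by lia
    have h1 := runSum_add_le_of_le (k := k) H.le hp hu.le hv.le hw
    have h2 := lexWeight_column_add (k := k) (p := p) (t := 1) (m := c) (by lia) (by lia)
    have h3 := lexWeight_column_add (k := k) hn hle
    have h4 := runSum_succ_mul (k := k) hp t
    have key : lexWeight k p 1 c + k * w + runSum k p w ≤ lexWeight k p (t + 1) (c + w) + w := by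
      rcases le_or_gt p c with hpc | hpc
      · have h5 := lexWeight_join_le (c := c) (a := 1) (σ := w) H ht (by lia) (by lia) (by lia)
        rw [lexWeight_of_le hT (by lia)] at h5
        linarith [Nat.cast_nonneg (α := ℤ) w]
      · have h5 := runSum_add_runSum_le (k := k) H.le hp c w
        have h6 : (c : ℤ) = p - 1 := by
          have : c + 1 = p := by lia
          linarith [show (c : ℤ) + 1 = p by exact_mod_cast this]
        have hkp : (k : ℤ) ≤ p := by exact_mod_cast H.le
        have h7 : (k : ℤ) * w ≤ p * w := by gcongr
        rw [lexWeight_of_le hn (by lia), lexWeight_of_le (by lia) (by lia)]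
        refine le_of_mul_le_mul_left (a := (p : ℤ)) ?_ (by exact_mod_cast hp)
        rw [h6] at h5
        linear_combination h5 + h7
    rw [show p + c + u + v = (t + 1) * p + (c + w) by lia, h3, h4]
    rw [one_mul] at h2
    rw [h2]
    have hw' : (u : ℤ) + v = t * p + w := by exact_mod_cast hw
    push_cast
    linear_combination h1 + key + k * hw'

/-- The full `p × p` grid and two segments in at most `p` columns of height `t * p` each. -/
theorem lexWeight_join_three_of_full (H : Admissible k p) (ht : 0 < t) {u v : ℕ}
    (hu : u ≤ p * (t * p)) (hv : v ≤ p * (t * p)) :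
    lexWeight k p 1 (p * p) + k * u + lexWeight k p t u + k * v + lexWeight k p t v ≤
      lexWeight k p (t + 1) (p * p + u + v) := by
  have hp := H.pos
  have hT : 0 < t * p := Nat.mul_pos ht hp
  have hn : 0 < (t + 1) * p := Nat.mul_pos t.succ_pos hp
  rcases le_or_gt (u + v) (p * (t * p)) with h | h
  · have h1 := lexWeight_superadd (k := k) H.le hp ht h
    have h2 := lexWeight_join_le (c := p * p) (a := p) (σ := u + v) H ht le_rfl le_rfl h
    rw [← add_assoc] at h2
    push_cast at h2
    linarith
  · obtain ⟨w, hw⟩ := Nat.exists_eq_add_of_le h.le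
    obtain ⟨A, hA⟩ := Nat.exists_eq_add_of_le hu
    obtain ⟨B, hB⟩ := Nat.exists_eq_add_of_le hv
    have f1 := lexWeight_add_of_add_eq (k := k) (t := t) (a := u) (b := A) hp le_rfl (by lia)
    have f2 := lexWeight_add_of_add_eq (k := k) (t := t) (a := v) (b := B) hp le_rfl (by lia)
    have f3 := lexWeight_add_of_add_eq (k := k) (t := t) (a := w) (b := A + B) hp le_rfl (by lia)
    have f4 := lexWeight_superadd (k := k) H.le hp ht (a := A) (b := B) (by lia)
    have f5 := lexWeight_le_succ H ht (m := w) (by lia)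
    have f6 := lexWeight_strip_add (k := k) hp hn w
    have f7 := lexWeight_mul (k := k) hn p
    have f8 := lexWeight_mul (k := k) hT p
    have f9 := runSum_succ_mul (k := k) hp t
    have hw' : (u : ℤ) + v = p * (t * p) + w := by exact_mod_cast hw
    rw [mul_comm ((t + 1) * p) p] at f7
    rw [show p * p + u + v = p * ((t + 1) * p) + w by
      have : p * ((t + 1) * p) = p * p + p * (t * p) := by ring
      lia, f6, f7, f9, lexWeight_one_full hp]
    push_cast at f3 ⊢
    linear_combination f1 + f2 - f3 + f4 + f5 + f8 + k * hw'

/-- At least as many cells as in `p` full columns, with the second segment contained in `α`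
columns, the third one in `β` columns, and at most `(p - α) * (p - β)` cells missing from the first
one. After removal of `p` full columns, the joint segment fits into `α + β - p` columns of height
`t * p`. All segments are replaced by their complements, so that superadditivity applies to the
missing cells. -/
theorem lexWeight_join_three_of_le (H : Admissible k p) (ht : 0 < t) {α β c u v : ℕ}
    (hα : α ≤ p) (hβ : β ≤ p) (hc : c ≤ p * p) (hu : u ≤ t * p * α) (hv : v ≤ t * p * β)
    (hη : p * p ≤ c + (p - α) * (p - β)) (hm : p * ((t + 1) * p) ≤ c + u + v) :
    lexWeight k p 1 c + k * u + lexWeight k p t u + k * v + lexWeight k p t v ≤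
      lexWeight k p (t + 1) (c + u + v) := by
  have hp := H.pos
  have hT : 0 < t * p := Nat.mul_pos ht hp
  have hn : 0 < (t + 1) * p := Nat.mul_pos t.succ_pos hp
  obtain ⟨η, hη'⟩ := Nat.exists_eq_add_of_le hc
  obtain ⟨A, hA⟩ := Nat.exists_eq_add_of_le hu
  obtain ⟨B, hB⟩ := Nat.exists_eq_add_of_le hv
  obtain ⟨w, hw⟩ := Nat.exists_eq_add_of_le hm
  obtain ⟨γ, hγ⟩ := Nat.exists_eq_add_of_le (show p ≤ α + β from
    Nat.le_of_mul_le_mul_left (show t * p * p ≤ t * p * (α + β) by lia) hT)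
  have e3 : t * p * (α + β) = t * p * p + t * p * γ := by rw [hγ, mul_add]
  have hwγ : w + (η + A + B) = t * p * γ := by lia
  have hγp : t * p * γ ≤ p * (t * p) := by
    rw [mul_comm p]
    exact Nat.mul_le_mul_left _ (by lia)
  have f1 := lexWeight_add_of_add_eq (k := k) (p := p) (t := 1) (a := c) (b := η) (γ := p) hp le_rfl
    (by lia)
  have f2 := lexWeight_add_of_add_eq (k := k) hp hα hA.symm
  have f3 := lexWeight_add_of_add_eq (k := k) hp hβ hB.symm
  have f4 := lexWeight_add_of_add_eq (k := k) hp (by lia) hwγ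
  have f5 := lexWeight_superadd (k := k) H.le hp ht (a := η + A) (b := B) (by lia)
  have f6 := lexWeight_superadd (k := k) H.le hp ht (a := η) (b := A) (by lia)
  have f7 := lexWeight_one_le (k := k) (m := η) H ht (by lia)
  have f8 := lexWeight_le_succ H ht (m := w) (by lia)
  have f9 := lexWeight_strip_add (k := k) hp hn w
  have g1 := lexWeight_mul (k := k) hn p
  have g2 := lexWeight_mul (k := k) hT α
  have g3 := lexWeight_mul (k := k) hT β
  have g4 := lexWeight_mul (k := k) hT γ
  have g5 := runSum_succ_mul (k := k) hp t
  have g6 := lexWeight_one_full (k := k) hp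
  have s0 := two_mul_runSum_of_le (k := k) (le_refl p)
  have s1 := two_mul_runSum_of_le (k := k) hα
  have s2 := two_mul_runSum_of_le (k := k) hβ
  have s3 := two_mul_runSum_of_le (k := k) (p := p) (h := γ) (by lia)
  have hγ' : (γ : ℤ) = α + β - p := by
    have : (α : ℤ) + β = p + γ := by exact_mod_cast hγ
    linarith
  have zη : (c : ℤ) = p * p - η := by
    have : (p : ℤ) * p = c + η := by exact_mod_cast hη'
    linarith
  have zu : (u : ℤ) = t * p * α - A := by
    have : (t : ℤ) * p * α = u + A := by exact_mod_cast hA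
    linarith
  have zv : (v : ℤ) = t * p * β - B := by
    have : (t : ℤ) * p * β = v + B := by exact_mod_cast hB
    linarith
  have zw : (w : ℤ) = t * p * γ - (η + A + B) := by
    have : (w : ℤ) + (η + A + B) = t * p * γ := by exact_mod_cast hwγ
    linarith
  have zα : (0 : ℤ) ≤ p - α := sub_nonneg.2 (by exact_mod_cast hα)
  have zβ : (0 : ℤ) ≤ p - β := sub_nonneg.2 (by exact_mod_cast hβ)
  have zk : (0 : ℤ) ≤ p - k := sub_nonneg.2 (by exact_mod_cast H.le)
  have n1 : (0 : ℤ) ≤ (p - α) * (p - β) - η := by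
    have h : η ≤ (p - α) * (p - β) := by lia
    have h' : (η : ℤ) ≤ ((p - α) * (p - β) : ℕ) := by exact_mod_cast h
    rw [Nat.cast_mul, Nat.cast_sub hα, Nat.cast_sub hβ] at h'
    linarith
  have n2 : (0 : ℤ) ≤ t * p * ((p - α) * (p - β) - η) := mul_nonneg (by positivity) n1
  have n3 : (0 : ℤ) ≤ η * (t * (p - k)) := by positivity
  have n4 : (0 : ℤ) ≤ (p - β) * A := by positivity
  have n5 : (0 : ℤ) ≤ (p - α) * B := by positivity
  have n6 : (0 : ℤ) ≤ η * ((p - α) + (p - β)) := by positivity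
  rw [mul_comm ((t + 1) * p) p] at g1
  rw [one_mul, g6] at f1
  rw [g2] at f2
  rw [g3] at f3
  rw [g4] at f4
  rw [g1, g5] at f9
  rw [hw, f9]
  push_cast at f1 f2 f3 f4 ⊢
  rw [hγ'] at zw
  rw [hγ'] at f4 s3
  rw [zu, zv, zw]
  refine le_of_mul_le_mul_left (a := (2 : ℤ)) ?_ two_pos
  linear_combination 2 * (f1 + f2 + f3 - f4 + f5 + f6 + f7 + f8 + n2 + n3 + n4 + n5 + n6)
    + t * p * (s1 + s2 - s3 - s0)

end JoinThree

/-! ### Diagrams of downsets -/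

/-- A downset of the `n × n` grid, given by the heights `h x` of its columns. -/
structure IsDiagram (n : ℕ) (h : ℕ → ℕ) : Prop where
  anti : Antitone h
  le : ∀ x, h x ≤ n
  eq_zero : ∀ x, n ≤ x → h x = 0

/-- The number of cells in the first `L` columns. -/
def cells (L : ℕ) (h : ℕ → ℕ) : ℕ := ∑ x ∈ range L, h x

/-- The weight of the first `L` columns. -/
def cellWeight (k p L : ℕ) (h : ℕ → ℕ) : ℤ :=
  ∑ x ∈ range L, (run k p x * h x + runSum k p (h x))

/-- Lexicographic initial segments maximize the weight among the downsets of the grid whose sides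
consist of `t` runs. -/
def LexOptimal (k p t : ℕ) : Prop :=
  ∀ h, IsDiagram (t * p) h → cellWeight k p (t * p) h ≤ lexWeight k p t (cells (t * p) h)

section Diagram

variable {k p t L T : ℕ} {f g h : ℕ → ℕ}

theorem cells_congr (hfg : ∀ x < L, f x = g x) : cells L f = cells L g :=
  sum_congr rfl fun x hx => hfg x (mem_range.1 hx)

theorem cellWeight_congr (hfg : ∀ x < L, f x = g x) : cellWeight k p L f = cellWeight k p L g :=
  sum_congr rfl fun x hx => by rw [hfg x (mem_range.1 hx)]

theorem cells_le_mul (hf : ∀ x < L, f x ≤ T) : cells L f ≤ L * T := by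
  unfold cells
  simpa using sum_le_card_nsmul (range L) f T fun x hx => hf x (mem_range.1 hx)

theorem cells_le_mul_of_eq_zero (hf : ∀ x, f x ≤ T) {a : ℕ} (ha : ∀ x, a ≤ x → f x = 0) :
    cells L f ≤ a * T := by
  suffices cells L f ≤ min L a * T from
    this.trans (Nat.mul_le_mul_right _ (min_le_right _ _))
  induction L with
  | zero => simp [cells]
  | succ L ih =>
    unfold cells at ih ⊢
    rw [sum_range_succ]
    rcases le_or_gt a L with h | h
    · rw [ha L h, min_eq_right (by lia)]
      rwa [min_eq_right h] at ih
    · rw [min_eq_left h.le] at ih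
      rw [min_eq_left (by lia), add_one_mul]
      exact add_le_add ih (hf L)

theorem cells_split :
    cells ((t + 1) * p) h = cells p (fun x => min (h x) p) + cells p (fun x => h x - p) +
      cells (t * p) (fun x => h (p + x)) := by
  unfold cells
  rw [show (t + 1) * p = p + t * p by ring, sum_range_add, ← sum_add_distrib]
  congr 1
  exact sum_congr rfl fun x _ => by lia

theorem cellWeight_split (hp : 0 < p) :
    cellWeight k p ((t + 1) * p) h =
      cellWeight k p p (fun x => min (h x) p) + k * cells p (fun x => h x - p) +
      cellWeight k p p (fun x => h x - p) + k * cells (t * p) (fun x => h (p + x)) +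
      cellWeight k p (t * p) (fun x => h (p + x)) := by
  have e1 : ∑ x ∈ range p, (run k p x * h x + runSum k p (h x)) =
      cellWeight k p p (fun x => min (h x) p) + k * cells p (fun x => h x - p) +
        cellWeight k p p (fun x => h x - p) := by
    unfold cellWeight cells
    rw [Nat.cast_sum, mul_sum, ← sum_add_distrib, ← sum_add_distrib]
    refine sum_congr rfl fun x _ => ?_
    rcases le_total (h x) p with hx | hx
    · simp [hx, runSum_zero]
    · obtain ⟨y, hy⟩ := Nat.exists_eq_add_of_le hx
      beta_reduce
      rw [min_eq_right hx, hy, runSum_period_add hp, Nat.add_sub_cancel_left]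
      push_cast
      ring
  have e2 : ∑ x ∈ range (t * p), (run k p (p + x) * h (p + x) + runSum k p (h (p + x))) =
      k * cells (t * p) (fun x => h (p + x)) + cellWeight k p (t * p) (fun x => h (p + x)) := by
    unfold cellWeight cells
    rw [Nat.cast_sum, mul_sum, ← sum_add_distrib]
    refine sum_congr rfl fun x _ => ?_
    have := run_mul_add (k := k) hp 1 x
    rw [mul_one] at this
    rw [this]
    push_cast
    ring
  rw [add_assoc _ (_ * _), ← e1, ← e2, cellWeight, show (t + 1) * p = p + t * p by ring,
    sum_range_add]

theorem LexOptimal.cellWeight_le (ht : LexOptimal k p t) (hf : Antitone f)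
    (hfT : ∀ x, f x ≤ t * p) (hL : L ≤ t * p) :
    cellWeight k p L f ≤ lexWeight k p t (cells L f) := by
  obtain ⟨c, hc⟩ := Nat.exists_eq_add_of_le hL
  have h := ht (fun x => if x < L then f x else 0)
    ⟨fun x y hxy => by
        have := hf hxy
        split_ifs <;> lia,
      fun x => by
        have := hfT x
        split_ifs <;> lia,
      fun x hx => if_neg (by lia)⟩
  have e1 : cells (t * p) (fun x => if x < L then f x else 0) = cells L f := by
    unfold cells
    rw [hc, sum_range_add, sum_eq_zero (s := range c) (fun x _ => if_neg (by lia)), add_zero]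
    exact sum_congr rfl fun x hx => if_pos (mem_range.1 hx)
  have e2 : cellWeight k p (t * p) (fun x => if x < L then f x else 0) = cellWeight k p L f := by
    unfold cellWeight
    rw [hc, sum_range_add, sum_eq_zero (s := range c)
      (fun x _ => by simp [runSum_zero]), add_zero]
    exact sum_congr rfl fun x hx => by simp [mem_range.1 hx]
  rwa [e1, e2] at h

/-- The bound obtained from the three parts of a diagram: its part in the `p × p` grid, the part
above it, and the part to the right of both. -/
theorem IsDiagram.cellWeight_le (hp : 0 < p) (ht : 0 < t) (h1 : LexOptimal k p 1)
    (h2 : LexOptimal k p t) (hh : IsDiagram ((t + 1) * p) h) (hhp : h p ≤ t * p) :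
    cellWeight k p ((t + 1) * p) h ≤
      lexWeight k p 1 (cells p (fun x => min (h x) p)) + k * cells p (fun x => h x - p) +
      lexWeight k p t (cells p (fun x => h x - p)) + k * cells (t * p) (fun x => h (p + x)) +
      lexWeight k p t (cells (t * p) (fun x => h (p + x))) := by
  have hpT : p ≤ t * p := Nat.le_mul_of_pos_left p ht
  rw [cellWeight_split hp]
  have e1 := h1.cellWeight_le (L := p) (f := fun x => min (h x) p)
    (fun x y hxy => by have := hh.anti hxy; dsimp only; lia) (fun x => by lia) (by lia)
  have e2 := h2.cellWeight_le (L := p) (f := fun x => h x - p)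
    (fun x y hxy => by have := hh.anti hxy; dsimp only; lia)
    (fun x => by have := hh.le x; lia) hpT
  have e3 := h2.cellWeight_le (L := t * p) (f := fun x => h (p + x))
    (fun x y hxy => hh.anti (by lia)) (fun x => (hh.anti (by lia)).trans hhp) le_rfl
  linarith

/-- The column heights of the lexicographic initial segment with `u` cells, in columns of
height `T`. -/
def columnFill (T u x : ℕ) : ℕ := min T (u - x * T)

theorem cells_columnFill (T u L : ℕ) : cells L (columnFill T u) = min u (L * T) := by
  induction L with
  | zero => simp [cells]
  | succ L ih =>
    unfold cells columnFill at ih ⊢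
    rw [sum_range_succ, ih, add_one_mul]
    lia

theorem cellWeight_columnFill (hT : 0 < t * p) (u L : ℕ) :
    cellWeight k p L (columnFill (t * p) u) = lexWeight k p t (min u (L * (t * p))) := by
  induction L with
  | zero => simp [cellWeight, lexWeight_zero]
  | succ L ih =>
    unfold cellWeight at ih ⊢
    rw [sum_range_succ, ih, columnFill, add_one_mul]
    rcases le_total u (L * (t * p)) with h | h
    · rw [min_eq_left h, min_eq_left (h.trans (by lia)), Nat.sub_eq_zero_of_le h]
      simp [runSum_zero]
    · obtain ⟨r, rfl⟩ := Nat.exists_eq_add_of_le h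
      rw [min_eq_right h, Nat.add_sub_cancel_left, min_add_add_left, mul_comm L,
        lexWeight_mul_add hT L (min_le_right _ _), min_comm r]
      ring

/-- The column heights of the initial segment with `v` cells of the row-by-row order, in rows of
length `T`. -/
def rowFill (T v x : ℕ) : ℕ := v / T + if x < v % T then 1 else 0

theorem rowFill_antitone (T v : ℕ) : Antitone (rowFill T v) := by
  intro x y hxy
  unfold rowFill
  split_ifs <;> lia

theorem rowFill_le {v b : ℕ} (hv : v ≤ T * b) (x : ℕ) : rowFill T v x ≤ b := by
  unfold rowFill
  have h := Nat.div_add_mod v T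
  split_ifs with hx
  · refine Nat.lt_of_mul_lt_mul_left (a := T) (by lia)
  · rcases Nat.eq_zero_or_pos T with rfl | hT
    · simp
    · exact Nat.div_le_of_le_mul hv

theorem cells_rowFill (hT : 0 < T) (v : ℕ) : cells T (rowFill T v) = v := by
  obtain ⟨e, he⟩ := Nat.exists_eq_add_of_lt (Nat.mod_lt v hT)
  have hv := Nat.div_add_mod v T
  unfold cells rowFill
  rw [sum_add_distrib, sum_const, card_range, smul_eq_mul, sum_boole]
  rw [show (range T).filter (fun x => x < v % T) = range (v % T) by ext x; simp; lia]
  simpa using hv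

theorem cellWeight_rowFill (hT : 0 < t * p) (v : ℕ) :
    cellWeight k p (t * p) (rowFill (t * p) v) = lexWeight k p t v := by
  obtain ⟨q, r, hr, rfl⟩ := exists_mul_add hT v
  rw [lexWeight_mul_add hT q hr.le, lexWeight_mul hT]
  have e : ∀ x, run k p x * (rowFill (t * p) (t * p * q + r) x : ℕ) +
      runSum k p (rowFill (t * p) (t * p * q + r) x) =
      run k p x * q + runSum k p q + if x < r then run k p x + run k p q else 0 := by
    intro x
    unfold rowFill
    rw [Nat.mul_add_div hT, Nat.mul_add_mod, Nat.div_eq_of_lt hr, Nat.mod_eq_of_lt hr, add_zero]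
    split_ifs
    · rw [runSum_succ]
      push_cast
      ring
    · simp
  unfold cellWeight
  rw [sum_congr rfl fun x _ => e x, sum_add_distrib, sum_add_distrib, ← sum_mul, ← sum_filter,
    show (range (t * p)).filter (fun x => x < r) = range r by ext x; simp; lia, sum_add_distrib]
  simp only [sum_const, card_range, nsmul_eq_mul]
  unfold runSum
  push_cast
  ring

/-! ### Removal of a column, of a row, and of `p` rows -/

theorem cells_shift {n : ℕ} (hn : h n = 0) : cells n h = h 0 + cells n (fun x => h (x + 1)) := by
  unfold cells
  have h1 := sum_range_succ h n
  have h2 := sum_range_succ' h n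
  lia

theorem cellWeight_shift_le (H : Admissible k p) {n : ℕ} (hn : h n = 0) :
    cellWeight k p n h ≤
      runSum k p (h 0) + cells n (fun x => h (x + 1)) + cellWeight k p n fun x => h (x + 1) := by
  unfold cells cellWeight
  have h1 := sum_range_succ (fun x => run k p x * h x + runSum k p (h x)) n
  have h2 := sum_range_succ' (fun x => run k p x * h x + runSum k p (h x)) n
  have h3 : ∑ x ∈ range n, (run k p (x + 1) * h (x + 1) + runSum k p (h (x + 1))) ≤
      ∑ x ∈ range n, ((h (x + 1) : ℤ) + (run k p x * h (x + 1) + runSum k p (h (x + 1)))) := by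
    refine sum_le_sum fun x _ => ?_
    have := mul_le_mul_of_nonneg_right (run_succ_le H x) (Nat.cast_nonneg (α := ℤ) (h (x + 1)))
    linarith
  rw [sum_add_distrib (f := fun x => (h (x + 1) : ℤ))] at h3
  have h4 : run k p 0 = 0 := by simp [run]
  simp only [hn, h4, runSum_zero, Nat.cast_zero, mul_zero, zero_mul, zero_add, add_zero] at h1 h2
  push_cast
  rw [← h1, h2]
  linarith

theorem cells_sub {n a : ℕ} (hh : ∀ x < n, a ≤ h x) :
    cells n h = n * a + cells n (fun x => h x - a) := by
  unfold cells
  rw [show n * a = ∑ _x ∈ range n, a by simp, ← sum_add_distrib]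
  refine sum_congr rfl fun x hx => ?_
  have := hh x (mem_range.1 hx)
  lia

theorem cellWeight_sub_one_le (hkp : k ≤ p) {n : ℕ} (hh : ∀ x < n, 1 ≤ h x) :
    cellWeight k p n h ≤
      runSum k p n + cells n (fun x => h x - 1) + cellWeight k p n fun x => h x - 1 := by
  unfold cells cellWeight
  rw [runSum, Nat.cast_sum, ← sum_add_distrib, ← sum_add_distrib]
  refine sum_le_sum fun x hx => ?_
  obtain ⟨y, hy⟩ := Nat.exists_eq_add_of_le (hh x (mem_range.1 hx))
  rw [hy, Nat.add_sub_cancel_left, add_comm 1 y, runSum_succ]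
  have := run_le_self hkp y
  simp only [hy, Nat.add_sub_cancel_left]
  push_cast
  linarith

theorem cellWeight_sub (hp : 0 < p) {n : ℕ} (hh : ∀ x < n, p ≤ h x) :
    cellWeight k p n h = p * runSum k p n + n * runSum k p p +
      k * cells n (fun x => h x - p) + cellWeight k p n fun x => h x - p := by
  have e : ∀ x ∈ range n, run k p x * h x + runSum k p (h x) = p * run k p x + runSum k p p +
      k * (h x - p : ℕ) + (run k p x * (h x - p : ℕ) + runSum k p (h x - p)) := by
    intro x hx
    obtain ⟨y, hy⟩ := Nat.exists_eq_add_of_le (hh x (mem_range.1 hx))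
    rw [hy, Nat.add_sub_cancel_left, runSum_period_add hp]
    push_cast
    ring
  unfold cells cellWeight
  rw [sum_congr rfl e, sum_add_distrib, sum_add_distrib, sum_add_distrib, ← mul_sum, ← mul_sum]
  simp [runSum]

end Diagram

/-! ### Diagrams whose right-hand part fits into the smaller grid -/

section Corner

variable {k p t : ℕ} {h : ℕ → ℕ}

theorem IsDiagram.le_of_corner (hh : IsDiagram ((t + 1) * p) h) (ht : 0 < t)
    (hc : h (p - 1) < p) : h p ≤ t * p := by
  have h1 := hh.anti (Nat.sub_le p 1)
  have h2 := Nat.le_mul_of_pos_left p ht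
  lia

/-- At least as many cells as in `p` full columns, with the `p × p` grid not full. -/
theorem cellWeight_le_of_many (H : Admissible k p) (ht : 0 < t) (h1 : LexOptimal k p 1)
    (h2 : LexOptimal k p t) (hh : IsDiagram ((t + 1) * p) h) (hc : h (p - 1) < p)
    (hm : p * ((t + 1) * p) ≤ cells ((t + 1) * p) h) :
    cellWeight k p ((t + 1) * p) h ≤ lexWeight k p (t + 1) (cells ((t + 1) * p) h) := by
  have hp := H.pos
  refine (hh.cellWeight_le hp ht h1 h2 (hh.le_of_corner ht hc)).trans ?_
  rw [cells_split] at hm ⊢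
  -- the number of columns of the `p × p` grid that are full, and the number of the others
  obtain ⟨α, hα⟩ : ∃ α, α = ∑ x ∈ range p, if p ≤ h x then 1 else 0 := ⟨_, rfl⟩
  obtain ⟨α', hα'⟩ : ∃ α, α = ∑ x ∈ range p, if p ≤ h x then 0 else 1 := ⟨_, rfl⟩
  have hαα : α + α' = p := by
    rw [hα, hα', ← sum_add_distrib,
      sum_congr rfl (g := fun _ => 1) fun x _ => by split_ifs <;> rfl]
    simp
  refine lexWeight_join_three_of_le H ht (α := α) (β := h (p - 1)) (by lia) hc.le ?_ ?_ ?_ ?_ hm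
  · exact cells_le_mul fun x _ => min_le_right _ _
  · rw [hα, mul_sum]
    refine sum_le_sum fun x _ => ?_
    have := hh.le x
    split_ifs <;> lia
  · refine cells_le_mul fun x _ => hh.anti (by lia)
  · have e : (p - α) * (p - h (p - 1)) =
        ∑ x ∈ range p, (if p ≤ h x then 0 else 1) * (p - h (p - 1)) := by
      rw [← sum_mul, ← hα']
      congr 1
      lia
    rw [e, cells, ← sum_add_distrib]
    rw [show p * p = ∑ _x ∈ range p, p by simp]
    refine sum_le_sum fun x hx => ?_
    have := hh.anti (show x ≤ p - 1 by have := mem_range.1 hx; lia)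
    split_ifs <;> lia

/-- The parts above and to the right of the `p × p` grid have fewer than `t * p` cells each. -/
theorem cellWeight_le_of_few (H : Admissible k p) (ht : 0 < t) (h1 : LexOptimal k p 1)
    (h2 : LexOptimal k p t) (hh : IsDiagram ((t + 1) * p) h) (hc : h (p - 1) < p)
    (hm : cells ((t + 1) * p) h ≤ p * ((t + 1) * p))
    (hu : cells p (fun x => h x - p) < t * p) (hv : cells (t * p) (fun x => h (p + x)) < t * p) :
    cellWeight k p ((t + 1) * p) h ≤ lexWeight k p (t + 1) (cells ((t + 1) * p) h) := by
  have hp := H.pos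
  refine (hh.cellWeight_le hp ht h1 h2 (hh.le_of_corner ht hc)).trans ?_
  rw [cells_split] at hm ⊢
  obtain ⟨q, rfl⟩ : ∃ q, p = q + 1 := ⟨p - 1, by lia⟩
  have hcells : cells (q + 1) (fun x => min (h x) (q + 1)) =
      min (h 0) (q + 1) + ∑ x ∈ range q, min (h (x + 1)) (q + 1) := by
    rw [cells, sum_range_succ', add_comm]
  have hu0 : 0 < cells (q + 1) (fun x => h x - (q + 1)) → q + 1 ≤ h 0 := by
    intro hpos
    by_contra hlt
    have := cells_le_mul_of_eq_zero (L := q + 1) (f := fun x => h x - (q + 1))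
      (T := (t + 1) * (q + 1)) (a := 0) (fun x => by have := hh.le x; lia)
      (fun x _ => by have := hh.anti (Nat.zero_le x); lia)
    lia
  have hv0 : 0 < cells (t * (q + 1)) (fun x => h (q + 1 + x)) → 1 ≤ h (q + 1) := by
    intro hpos
    by_contra hlt
    have := cells_le_mul_of_eq_zero (L := t * (q + 1)) (f := fun x => h (q + 1 + x))
      (T := (t + 1) * (q + 1)) (a := 0) (fun x => hh.le _)
      (fun x _ => by have := hh.anti (show q + 1 ≤ q + 1 + x by lia); lia)
    lia
  have hv1 : 1 ≤ h (q + 1) → q ≤ ∑ x ∈ range q, min (h (x + 1)) (q + 1) := by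
    intro h1
    have := sum_le_sum (s := range q) (f := fun _ => 1) (g := fun x => min (h (x + 1)) (q + 1))
      fun x hx => by
        have := hh.anti (show x + 1 ≤ q + 1 by have := mem_range.1 hx; lia)
        lia
    simpa using this
  refine lexWeight_join_three_of_lt H ht (cells_le_mul fun x _ => min_le_right _ _) hu hv ?_ ?_ ?_
    hm
  · intro hpos
    have := hu0 hpos
    lia
  · intro hpos
    have h3 := hv0 hpos
    have h4 := hv1 h3
    have h5 := hh.anti (Nat.zero_le (q + 1))
    lia
  · intro hpos hpos'
    have h3 := hu0 hpos
    have h4 := hv1 (hv0 hpos')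
    lia

/-- The part above the `p × p` grid has at least `t * p` cells: rearranged lexicographically, it
completes the first column of the diagram. -/
theorem cellWeight_le_of_column (H : Admissible k p) (ht : 0 < t)
    (h2 : LexOptimal k p t) (hh : IsDiagram ((t + 1) * p) h) (hc : h (p - 1) < p)
    (hm : cells ((t + 1) * p) h ≤ p * ((t + 1) * p))
    (hu : t * p ≤ cells p (fun x => h x - p))
    (ih : ∀ g, IsDiagram ((t + 1) * p) g → g p ≤ t * p →
      cells ((t + 1) * p) g < cells ((t + 1) * p) h →
      cellWeight k p ((t + 1) * p) g ≤ lexWeight k p (t + 1) (cells ((t + 1) * p) g)) :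
    cellWeight k p ((t + 1) * p) h ≤ lexWeight k p (t + 1) (cells ((t + 1) * p) h) := by
  have hp := H.pos
  have hT : 0 < t * p := Nat.mul_pos ht hp
  have hn : 0 < (t + 1) * p := Nat.mul_pos t.succ_pos hp
  have hpT : p ≤ t * p := Nat.le_mul_of_pos_left p ht
  set u := cells p (fun x => h x - p) with hu_def
  have hu_le : u ≤ p * (t * p) := cells_le_mul fun x _ => by have := hh.le x; lia
  set g : ℕ → ℕ := fun x => if x < p then min (h x) p + columnFill (t * p) u x else h x with hg
  -- the part above lies over the columns of height at least `p`, and so does its rearrangement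
  have hfill : ∀ x, 0 < columnFill (t * p) u x → p ≤ h x := by
    intro x hx
    by_contra hlt
    have := cells_le_mul_of_eq_zero (L := p) (f := fun x => h x - p) (T := t * p)
      (a := x) (fun y => by have := hh.le y; lia)
      (fun y hy => by have := hh.anti hy; lia)
    unfold columnFill at hx
    lia
  have e1 : ∀ x < p, min (g x) p = min (h x) p := by
    intro x hx
    have := hfill x
    simp only [hg, if_pos hx]
    lia
  have e2 : ∀ x < p, g x - p = columnFill (t * p) u x := by
    intro x hx
    have := hfill x
    simp only [hg, if_pos hx]
    lia
  have e3 : ∀ x < t * p, g (p + x) = h (p + x) := by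
    intro x hx
    simp [hg]
  have e4 : cells p (fun x => g x - p) = u := by
    rw [cells_congr e2, cells_columnFill, min_eq_left hu_le]
  have hcells : cells ((t + 1) * p) g = cells ((t + 1) * p) h := by
    rw [cells_split, cells_split, cells_congr e1, e4, cells_congr e3]
  have hweight : cellWeight k p ((t + 1) * p) h ≤ cellWeight k p ((t + 1) * p) g := by
    have e5 := h2.cellWeight_le (L := p) (f := fun x => h x - p)
      (fun x y hxy => by have := hh.anti hxy; dsimp only; lia)
      (fun x => by have := hh.le x; lia) hpT
    rw [cellWeight_split hp, cellWeight_split hp, cellWeight_congr e1, e4, cells_congr e3,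
      cellWeight_congr e3, cellWeight_congr e2, cellWeight_columnFill hT, min_eq_left hu_le]
    linarith
  have hg0 : g 0 = (t + 1) * p := by
    have h3 := hfill 0
    have h4 : columnFill (t * p) u 0 = t * p := by unfold columnFill; lia
    simp only [hg, if_pos hp]
    lia
  have hgn : ∀ x, (t + 1) * p ≤ x → g x = 0 := by
    intro x hx
    simp only [hg]
    rw [if_neg (by lia)]
    exact hh.eq_zero x hx
  have hga : Antitone g := by
    intro x y hxy
    have h3 := hh.anti hxy
    have h4 : columnFill (t * p) u y ≤ columnFill (t * p) u x := by
      have := Nat.mul_le_mul_right (t * p) hxy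
      unfold columnFill
      lia
    simp only [hg]
    split_ifs with hy hx hx
    · lia
    · lia
    · have h5 := hh.anti (show x ≤ p - 1 by lia)
      have h6 := hh.anti (show p - 1 ≤ y by lia)
      lia
    · lia
  have hcells' := cells_shift (hgn _ le_rfl)
  have hweight' := cellWeight_shift_le H (hgn _ le_rfl)
  rw [hcells, hg0] at hcells'
  rw [hg0] at hweight'
  have hih := ih (fun x => g (x + 1))
    ⟨fun x y hxy => hga (by lia), fun x => (hga (Nat.zero_le _)).trans hg0.le,
      fun x hx => hgn _ (by lia)⟩
    (by
      have h3 : g (p + 1) = h (p + 1) := by simp [hg]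
      have h4 := hh.anti (Nat.le_succ p)
      have h5 := hh.le_of_corner ht hc
      lia) (by lia)
  have hlast := lexWeight_column_add (k := k) (m := cells ((t + 1) * p) fun x => g (x + 1)) hn
    (by lia)
  rw [hcells', hlast]
  linarith

/-- Rearranging row by row the part to the right of the `p × p` grid. -/
theorem IsDiagram.exists_rearrange_rows (hp : 0 < p) (ht : 0 < t) (h2 : LexOptimal k p t)
    (hh : IsDiagram ((t + 1) * p) h) (hcp : h p ≤ t * p) :
    ∃ g, IsDiagram ((t + 1) * p) g ∧ (∀ x < p, g x = h x) ∧
      (∀ x < t * p, g (p + x) = rowFill (t * p) (cells (t * p) fun x => h (p + x)) x) ∧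
      cells ((t + 1) * p) g = cells ((t + 1) * p) h ∧
      cellWeight k p ((t + 1) * p) h ≤ cellWeight k p ((t + 1) * p) g := by
  have hT : 0 < t * p := Nat.mul_pos ht hp
  set v := cells (t * p) (fun x => h (p + x)) with hv_def
  have hv : v ≤ t * p * h p := cells_le_mul fun x _ => hh.anti (by lia)
  set g : ℕ → ℕ := fun x =>
    if x < p then h x else if x < (t + 1) * p then rowFill (t * p) v (x - p) else 0 with hg
  have e1 : ∀ x < p, g x = h x := fun x hx => if_pos hx
  have e2 : ∀ x < t * p, g (p + x) = rowFill (t * p) v x := by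
    intro x hx
    simp only [hg]
    rw [if_neg (by lia), if_pos (by lia), Nat.add_sub_cancel_left]
  refine ⟨g, ⟨fun x y hxy => ?_, fun x => ?_, fun x hx => ?_⟩, e1, e2, ?_, ?_⟩
  · have h3 := hh.anti hxy
    have h4 := rowFill_antitone (t * p) v (show x - p ≤ y - p by lia)
    have h5 := rowFill_le hv (y - p)
    have h6 : x < p → h p ≤ h x := fun hx => hh.anti hx.le
    simp only [hg]
    split_ifs <;> lia
  · have h3 := rowFill_le hv (x - p)
    have h4 := hh.le x
    simp only [hg]
    split_ifs <;> lia
  · simp only [hg]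
    rw [if_neg (by lia), if_neg (by lia)]
  · rw [cells_split, cells_split, cells_congr e2, cells_rowFill hT, ← hv_def,
      cells_congr (f := fun x => min (g x) p) fun x hx => by rw [e1 x hx],
      cells_congr (f := fun x => g x - p) fun x hx => by rw [e1 x hx]]
  · have e5 := h2.cellWeight_le (L := t * p) (f := fun x => h (p + x))
      (fun x y hxy => hh.anti (by lia)) (fun x => (hh.anti (by lia)).trans hcp) le_rfl
    rw [cellWeight_split hp, cellWeight_split (h := g) hp, cells_congr e2, cellWeight_congr e2,
      cells_rowFill hT, cellWeight_rowFill hT, ← hv_def,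
      cellWeight_congr (f := fun x => min (g x) p) fun x hx => by rw [e1 x hx],
      cellWeight_congr (f := fun x => g x - p) fun x hx => by rw [e1 x hx],
      cells_congr (f := fun x => g x - p) fun x hx => by rw [e1 x hx]]
    rw [← hv_def] at e5
    linarith

/-- The part to the right of the `p × p` grid has at least `t * p` cells: rearranged row by row, it
completes the first row of the diagram. -/
theorem cellWeight_le_of_row (H : Admissible k p) (ht : 0 < t)
    (h2 : LexOptimal k p t) (hh : IsDiagram ((t + 1) * p) h) (hc : h (p - 1) < p)
    (hm : cells ((t + 1) * p) h ≤ p * ((t + 1) * p))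
    (hv : t * p ≤ cells (t * p) (fun x => h (p + x)))
    (ih : ∀ g, IsDiagram ((t + 1) * p) g → g p ≤ t * p →
      cells ((t + 1) * p) g < cells ((t + 1) * p) h →
      cellWeight k p ((t + 1) * p) g ≤ lexWeight k p (t + 1) (cells ((t + 1) * p) g)) :
    cellWeight k p ((t + 1) * p) h ≤ lexWeight k p (t + 1) (cells ((t + 1) * p) h) := by
  have hp := H.pos
  have hT : 0 < t * p := Nat.mul_pos ht hp
  have hn : 0 < (t + 1) * p := Nat.mul_pos t.succ_pos hp
  obtain ⟨g, hgd, hg1, hg2, hcells, hweight⟩ :=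
    hh.exists_rearrange_rows hp ht h2 (hh.le_of_corner ht hc)
  have hge : ∀ x < (t + 1) * p, 1 ≤ g x := by
    intro x hx
    have h3 := hgd.anti (show x ≤ p + (t * p - 1) by lia)
    rw [hg2 _ (by lia)] at h3
    have h4 := Nat.div_pos hv hT
    unfold rowFill at h3
    lia
  have hcells' := cells_sub hge
  have hweight' := cellWeight_sub_one_le H.le hge
  rw [hcells, mul_one] at hcells'
  have hih := ih (fun x => g x - 1)
    ⟨fun x y hxy => Nat.sub_le_sub_right (hgd.anti hxy) 1,
      fun x => (Nat.sub_le _ _).trans (hgd.le x),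
      fun x hx => by rw [hgd.eq_zero x hx]⟩
    (by
      have h3 := hg1 (p - 1) (by lia)
      have h4 := hgd.anti (Nat.sub_le p 1)
      have h5 := Nat.le_mul_of_pos_left p ht
      lia) (by lia)
  have hlast := lexWeight_column_add (k := k) (m := cells ((t + 1) * p) fun x => g x - 1) hn
    (by lia)
  rw [hcells', hlast]
  linarith

/-- The `p × p` grid is full and the part to its right has at least `p * (t * p)` cells: rearranged
row by row, it completes the first `p` rows of the diagram. -/
theorem cellWeight_le_of_rows (H : Admissible k p) (ht : 0 < t)
    (h2 : LexOptimal k p t) (hh : IsDiagram ((t + 1) * p) h) (hcp : h p ≤ t * p)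
    (hv : p * (t * p) ≤ cells (t * p) (fun x => h (p + x)))
    (ih : ∀ g, IsDiagram ((t + 1) * p) g → g p ≤ t * p →
      cells ((t + 1) * p) g < cells ((t + 1) * p) h →
      cellWeight k p ((t + 1) * p) g ≤ lexWeight k p (t + 1) (cells ((t + 1) * p) g)) :
    cellWeight k p ((t + 1) * p) h ≤ lexWeight k p (t + 1) (cells ((t + 1) * p) h) := by
  have hp := H.pos
  have hT : 0 < t * p := Nat.mul_pos ht hp
  have hn : 0 < (t + 1) * p := Nat.mul_pos t.succ_pos hp
  obtain ⟨g, hgd, hg1, hg2, hcells, hweight⟩ := hh.exists_rearrange_rows hp ht h2 hcp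
  have hge : ∀ x < (t + 1) * p, p ≤ g x := by
    intro x hx
    have h3 := hgd.anti (show x ≤ p + (t * p - 1) by lia)
    rw [hg2 _ (by lia)] at h3
    have h4 := (Nat.le_div_iff_mul_le hT).2 hv
    unfold rowFill at h3
    lia
  have hcells' := cells_sub hge
  have hweight' := cellWeight_sub (k := k) hp hge
  rw [hcells] at hcells'
  have hnp : 0 < (t + 1) * p * p := Nat.mul_pos hn hp
  have hih := ih (fun x => g x - p)
    ⟨fun x y hxy => Nat.sub_le_sub_right (hgd.anti hxy) p,
      fun x => (Nat.sub_le _ _).trans (hgd.le x),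
      fun x hx => by rw [hgd.eq_zero x hx, Nat.zero_sub]⟩
    (by have := hgd.le p; lia) (by lia)
  have hlast := lexWeight_strip_add (k := k) hp hn (cells ((t + 1) * p) fun x => g x - p)
  have hfull := lexWeight_mul (k := k) hn p
  rw [mul_comm ((t + 1) * p) p] at hcells' hfull
  rw [hfull] at hlast
  rw [hcells', hlast]
  push_cast at hweight' hih ⊢
  linarith

/-- The bound, by strong induction on the number of cells: either the three parts of the diagram can
be joined at once, or one of them can be rearranged in such a way that a full column, a full row or
`p` full rows can be removed. -/
theorem IsDiagram.cellWeight_le_lexWeight (H : Admissible k p) (ht : 0 < t) (h1 : LexOptimal k p 1)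
    (h2 : LexOptimal k p t) (hh : IsDiagram ((t + 1) * p) h) (hc : h p ≤ t * p) :
    cellWeight k p ((t + 1) * p) h ≤ lexWeight k p (t + 1) (cells ((t + 1) * p) h) := by
  have hp := H.pos
  induction hm : cells ((t + 1) * p) h using Nat.strong_induction_on generalizing h with
  | _ m ih =>
    subst hm
    have ih' : ∀ g, IsDiagram ((t + 1) * p) g → g p ≤ t * p →
        cells ((t + 1) * p) g < cells ((t + 1) * p) h →
        cellWeight k p ((t + 1) * p) g ≤ lexWeight k p (t + 1) (cells ((t + 1) * p) g) :=
      fun g hg hgc hlt => ih _ hlt hg hgc rfl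
    rcases lt_or_ge (h (p - 1)) p with hcor | hcor
    · rcases le_total (p * ((t + 1) * p)) (cells ((t + 1) * p) h) with hm | hm
      · exact cellWeight_le_of_many H ht h1 h2 hh hcor hm
      rcases le_or_gt (t * p) (cells p (fun x => h x - p)) with hu | hu
      · exact cellWeight_le_of_column H ht h2 hh hcor hm hu ih'
      rcases le_or_gt (t * p) (cells (t * p) (fun x => h (p + x))) with hv | hv
      · exact cellWeight_le_of_row H ht h2 hh hcor hm hv ih'
      exact cellWeight_le_of_few H ht h1 h2 hh hcor hm hu hv
    · rcases le_total (p * (t * p)) (cells (t * p) (fun x => h (p + x))) with hv | hv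
      · exact cellWeight_le_of_rows H ht h2 hh hc hv ih'
      refine (hh.cellWeight_le hp ht h1 h2 hc).trans ?_
      have hfull : cells p (fun x => min (h x) p) = p * p := by
        rw [cells, sum_congr rfl (g := fun _ => p) fun x hx => min_eq_right
          (hcor.trans (hh.anti (by have := mem_range.1 hx; lia)))]
        simp
      rw [cells_split, hfull]
      exact lexWeight_join_three_of_full H ht
        (cells_le_mul fun x _ => by have := hh.le x; lia) hv

end Corner

/-! ### Transposition and complementation -/

section Symmetry

variable {k p t n : ℕ} {h : ℕ → ℕ}

/-- The column heights of the transposed diagram, that is, the row lengths of the diagram. -/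
def transpose (n : ℕ) (h : ℕ → ℕ) (y : ℕ) : ℕ := #{x ∈ range n | y < h x}

theorem IsDiagram.lt_transpose_iff (hh : IsDiagram n h) {x : ℕ} (hx : x < n) (y : ℕ) :
    x < transpose n h y ↔ y < h x := by
  constructor
  · contrapose!
    intro hxy
    refine (card_le_card (t := range x) fun z hz => ?_).trans (card_range x).le
    rw [mem_filter] at hz
    rw [mem_range]
    by_contra hzx
    have := hh.anti (not_lt.1 hzx)
    lia
  · intro hxy
    refine lt_of_lt_of_le (Nat.lt_succ_self x) ((card_range (x + 1)).ge.trans (card_le_card ?_))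
    intro z hz
    rw [mem_range] at hz
    rw [mem_filter, mem_range]
    exact ⟨by lia, hxy.trans_le (hh.anti (by lia))⟩

theorem IsDiagram.transpose (hh : IsDiagram n h) : IsDiagram n (transpose n h) where
  anti := fun y z hyz => card_le_card (monotone_filter_right _ fun x hx hz => lt_of_le_of_lt hyz hz)
  le := fun y => (card_filter_le _ _).trans (card_range n).le
  eq_zero := fun y hy => card_eq_zero.2 (filter_eq_empty_iff.2 fun x _ => by
    have := hh.le x
    lia)

theorem IsDiagram.cells_eq (hh : IsDiagram n h) :
    cells n h = ∑ x ∈ range n, ∑ y ∈ range n, if y < h x then 1 else 0 := by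
  refine sum_congr rfl fun x _ => ?_
  rw [← sum_filter, show (range n).filter (fun y => y < h x) = range (h x) by
    ext y
    have := hh.le x
    simp
    lia]
  simp

theorem IsDiagram.cellWeight_eq (hh : IsDiagram n h) :
    cellWeight k p n h =
      ∑ x ∈ range n, ∑ y ∈ range n, if y < h x then run k p x + run k p y else 0 := by
  refine sum_congr rfl fun x _ => ?_
  rw [← sum_filter, show (range n).filter (fun y => y < h x) = range (h x) by
    ext y
    have := hh.le x
    simp
    lia, sum_add_distrib, runSum]
  simp [mul_comm]

theorem IsDiagram.cells_transpose (hh : IsDiagram n h) :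
    cells n (RunGrid.transpose n h) = cells n h := by
  rw [hh.cells_eq, hh.transpose.cells_eq, sum_comm]
  refine sum_congr rfl fun x hx => sum_congr rfl fun y _ => ?_
  simp only [hh.lt_transpose_iff (mem_range.1 hx)]

theorem IsDiagram.cellWeight_transpose (hh : IsDiagram n h) :
    cellWeight k p n (RunGrid.transpose n h) = cellWeight k p n h := by
  rw [hh.cellWeight_eq, hh.transpose.cellWeight_eq, sum_comm]
  refine sum_congr rfl fun x hx => sum_congr rfl fun y _ => ?_
  simp only [hh.lt_transpose_iff (mem_range.1 hx), add_comm]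

/-- The column heights of the complement of the diagram, turned by half a turn. -/
def complement (n : ℕ) (h : ℕ → ℕ) (x : ℕ) : ℕ := if x < n then n - h (n - 1 - x) else 0

theorem IsDiagram.complement (hh : IsDiagram n h) : IsDiagram n (complement n h) where
  anti := fun x y hxy => by
    have := hh.anti (show n - 1 - y ≤ n - 1 - x by lia)
    unfold RunGrid.complement
    split_ifs <;> lia
  le := fun x => by
    unfold RunGrid.complement
    split_ifs <;> lia
  eq_zero := fun x hx => if_neg (by lia)

theorem complement_reflect {x : ℕ} (hx : x < n) : complement n h (n - 1 - x) = n - h x := by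
  unfold complement
  rw [if_pos (by lia), show n - 1 - (n - 1 - x) = x by lia]

theorem IsDiagram.cells_complement (hh : IsDiagram n h) :
    cells n (RunGrid.complement n h) + cells n h = n * n := by
  unfold cells
  rw [← sum_range_reflect, ← sum_add_distrib,
    sum_congr rfl (g := fun _ => n) fun x hx => by
      rw [complement_reflect (mem_range.1 hx)]
      have := hh.le x
      lia]
  simp

theorem IsDiagram.cellWeight_complement (hp : 0 < p) (hh : IsDiagram (t * p) h) :
    cellWeight k p (t * p) (RunGrid.complement (t * p) h) =
      cellWeight k p (t * p) h +
        ((t - 1) * k + (p - 1)) * (t * p * (t * p) - 2 * cells (t * p) h) := by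
  have e : ∀ x ∈ range (t * p),
      run k p (t * p - 1 - x) * (RunGrid.complement (t * p) h (t * p - 1 - x) : ℕ) +
        runSum k p (RunGrid.complement (t * p) h (t * p - 1 - x)) =
      run k p x * h x + runSum k p (h x) - 2 * ((t - 1) * k + (p - 1)) * h x -
        (t * p) * run k p x + (t * p) * ((t - 1) * k + (p - 1)) + runSum k p (t * p) := by
    intro x hx
    obtain ⟨z, hz⟩ := Nat.exists_eq_add_of_le (hh.le x)
    have h1 := runSum_add_of_add_eq (k := k) hp (t := t) (a := z) (b := h x) (by lia)
    have h2 : (z : ℤ) = t * p - h x := by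
      have : (t * p : ℤ) = h x + z := by exact_mod_cast hz
      linarith
    rw [complement_reflect (mem_range.1 hx), run_reflect hp (mem_range.1 hx),
      show t * p - h x = z by lia, h2]
    linear_combination h1
  unfold cellWeight cells
  rw [← sum_range_reflect, sum_congr rfl e]
  simp only [sum_add_distrib, sum_sub_distrib, ← mul_sum]
  simp only [sum_const, card_range, nsmul_eq_mul]
  rw [← runSum]
  push_cast
  ring

theorem lexWeight_sq (hT : 0 < t * p) (hp : 0 < p) :
    lexWeight k p t (t * p * (t * p)) = ((t - 1) * k + (p - 1)) * (t * p * (t * p)) := by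
  have h1 := lexWeight_mul (k := k) hT (t * p)
  have h2 := runSum_add_of_add_eq (k := k) hp (t := t) (zero_add (t * p))
  rw [runSum_zero] at h2
  push_cast at h1 h2
  linear_combination h1 - (t * p) * h2

/-! ### Optimality of the lexicographic order -/

/-- The induction step. If more than `p` columns are higher than `t * p`, the part to the right does
not fit into the smaller grid. If in addition column `t * p` has at most `p` cells, then at most
`p` rows are longer than `t * p`, and the diagram can be transposed; otherwise it can be replaced
by its complement. -/
theorem LexOptimal.succ (H : Admissible k p) (ht : 0 < t) (h1 : LexOptimal k p 1)
    (h2 : LexOptimal k p t) : LexOptimal k p (t + 1) := by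
  intro h hh
  have hp := H.pos
  have hn : 0 < (t + 1) * p := Nat.mul_pos t.succ_pos hp
  by_cases hc : h p ≤ t * p
  · exact hh.cellWeight_le_lexWeight H ht h1 h2 hc
  rcases le_or_gt (h (t * p)) p with htp | htp
  · rw [← hh.cells_transpose, ← hh.cellWeight_transpose]
    refine hh.transpose.cellWeight_le_lexWeight H ht h1 h2 ?_
    by_contra hlt
    rw [not_le, hh.lt_transpose_iff (by lia)] at hlt
    lia
  · have h3 := hh.complement.cellWeight_le_lexWeight H ht h1 h2 (by
      unfold complement
      have := hh.anti (show (t + 1) * p - 1 - p ≤ t * p by lia)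
      split_ifs <;> lia)
    rw [hh.cellWeight_complement hp] at h3
    have h4 := lexWeight_add_of_add_eq_sq (k := k) hp hh.cells_complement
    rw [lexWeight_sq hn hp] at h4
    linarith

theorem LexOptimal.of_one (H : Admissible k p) (h1 : LexOptimal k p 1) (ht : 0 < t) :
    LexOptimal k p t := by
  induction t, ht using Nat.le_induction with
  | base => exact h1
  | succ t ht ih => exact LexOptimal.succ H ht h1 ih

theorem lexOptimal_one_one_one : LexOptimal 1 1 1 := by
  intro h hh
  have h0 := hh.le 0
  refine le_trans (le_of_eq ?_) (lexWeight_nonneg _)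
  simp only [cellWeight, mul_one, range_one, sum_singleton]
  interval_cases h 0 <;> simp [run, runSum]

/-- A single run: the sequence is then the identity, which is also the sequence of `p` runs of
length one with consecutive starting points, so that this case is an instance of
`LexOptimal.of_one`. -/
theorem lexOptimal_one (hp : 0 < p) : LexOptimal k p 1 := by
  intro h hh
  rw [one_mul] at *
  have h1 := LexOptimal.of_one ⟨le_rfl, le_rfl, by lia⟩ lexOptimal_one_one_one hp h
    (by rwa [mul_one])
  rw [mul_one] at h1
  have e : ∀ x < p, run k p x = run 1 1 x := fun x hx => by
    rw [run_of_lt hx]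
    simp [run]
  have e1 : cellWeight k p p h = cellWeight 1 1 p h := by
    refine sum_congr rfl fun x hx => ?_
    rw [e x (mem_range.1 hx)]
    congr 1
    exact sum_congr rfl fun y hy => e y ((mem_range.1 hy).trans_le (hh.le x))
  have e2 : lexWeight k p 1 (cells p h) = lexWeight 1 1 p (cells p h) := by
    refine sum_congr rfl fun j hj => ?_
    have hj : j < p * p := (mem_range.1 hj).trans_le (cells_le_mul fun x _ => hh.le x)
    rw [one_mul, mul_one, e _ (Nat.div_lt_of_lt_mul hj), e _ (Nat.mod_lt _ hp)]
  rw [e1, e2]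
  exact h1

theorem lexOptimal (H : Admissible k p) (ht : 0 < t) : LexOptimal k p t :=
  LexOptimal.of_one H (lexOptimal_one H.pos) ht

end Symmetry

/-! ### Sets of cells in a finite linear order squared -/

section Cells

variable {k p t n : ℕ}

/-- A set that is initial with respect to an injective numbering carries the first numbers. -/
theorem image_eq_range {W : Type*} {c : W → ℕ} (hc : c.Injective) {D : Finset W}
    (hD : ∀ z ∈ D, ∀ j < c z, ∃ w ∈ D, c w = j) : D.image c = range #D := by
  refine eq_of_subset_of_card_le (fun j hj => ?_) (by rw [card_image_of_injective D hc, card_range])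
  obtain ⟨z, hz, rfl⟩ := mem_image.1 hj
  have h : range (c z + 1) ⊆ D.image c := fun j hj => by
    rcases (Nat.lt_succ_iff.1 (mem_range.1 hj)).lt_or_eq with h | rfl
    · exact mem_image.2 (hD z hz j h)
    · exact mem_image_of_mem c hz
  have := card_le_card h
  rwa [card_range, card_image_of_injective D hc, Nat.succ_le_iff, ← mem_range] at this

theorem sum_eq_sum_range {W : Type*} {c : W → ℕ} (hc : c.Injective) {D : Finset W}
    (hD : ∀ z ∈ D, ∀ j < c z, ∃ w ∈ D, c w = j) (f : ℕ → ℤ) :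
    ∑ z ∈ D, f (c z) = ∑ j ∈ range #D, f j := by
  rw [← image_eq_range hc hD, sum_image hc.injOn]

variable {V : Type*}

/-- For columns of heights `a x`, in any order: the numbers of columns of height more than
`y = 0, 1, …` form a diagram, and its weight is the left-hand side. -/
theorem sum_runSum_le [Fintype V] (H : Admissible k p) (ht : 0 < t) {a : V → ℕ}
    (hV : Fintype.card V = t * p) (ha : ∀ x, a x ≤ t * p) :
    ∑ x, runSum k p (a x) + ∑ y ∈ range (t * p), runSum k p #{x | y < a x} ≤
      lexWeight k p t (∑ x, a x) := by
  set w : ℕ → ℕ := fun y => #{x | y < a x} with hw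
  have hd : IsDiagram (t * p) w :=
    ⟨fun y z hyz => card_le_card (monotone_filter_right _ fun x _ hx => lt_of_le_of_lt hyz hx),
      fun y => (card_filter_le _ _).trans hV.le,
      fun y hy => card_eq_zero.2 (filter_eq_empty_iff.2 fun x _ => by
        have := ha x
        lia)⟩
  have hrange : ∀ x, (range (t * p)).filter (fun y => y < a x) = range (a x) := fun x => by
    ext y
    have := ha x
    simp
    lia
  have h1 : cells (t * p) w = ∑ x, a x := by
    simp only [cells, hw, card_filter]
    rw [sum_comm]
    refine sum_congr rfl fun x _ => ?_
    rw [← sum_filter, hrange]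
    simp
  have h2 : ∑ y ∈ range (t * p), run k p y * (w y : ℤ) = ∑ x, runSum k p (a x) := by
    simp only [hw, card_filter, Nat.cast_sum, mul_sum]
    rw [sum_comm]
    refine sum_congr rfl fun x _ => ?_
    rw [runSum, ← hrange, sum_filter]
    refine sum_congr rfl fun y _ => ?_
    split_ifs <;> simp
  have h3 := lexOptimal H ht w hd
  rwa [h1, cellWeight, sum_add_distrib, h2] at h3

variable [LinearOrder V] (e : V ≃o Fin n)

theorem isLowerSet_map_ofLex {L : Finset (V ×ₗ V)} (hL : IsLowerSet (L : Set (V ×ₗ V))) :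
    IsLowerSet (L.map ofLex.toEmbedding : Set (V × V)) := by
  intro z w hwz hz
  rw [mem_coe, mem_map] at *
  obtain ⟨z, hz, rfl⟩ := hz
  exact ⟨toLex w, hL (Prod.Lex.toLex_mono hwz) hz, rfl⟩

theorem rank_injective : Function.Injective fun x => (e x : ℕ) :=
  Fin.val_injective.comp e.injective

theorem exists_rank_eq {D : Finset V} (hD : IsLowerSet (D : Set V)) {x : V} (hx : x ∈ D) {j : ℕ}
    (hj : j < e x) : ∃ w ∈ D, (e w : ℕ) = j := by
  refine ⟨e.symm ⟨j, hj.trans (e x).2⟩, hD ?_ hx, by simp⟩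
  rw [e.symm_apply_le]
  exact hj.le

theorem mem_iff_rank_lt {D : Finset V} (hD : IsLowerSet (D : Set V)) (x : V) :
    x ∈ D ↔ (e x : ℕ) < #D := by
  rw [← mem_range, ← image_eq_range (rank_injective e) fun z hz j hj => exists_rank_eq e hD hz hj,
    (rank_injective e).mem_finset_image]

theorem sum_run_of_isLowerSet {D : Finset V} (hD : IsLowerSet (D : Set V)) :
    ∑ x ∈ D, run k p (e x) = runSum k p #D :=
  sum_eq_sum_range (rank_injective e) (fun _ hz _ hj => exists_rank_eq e hD hz hj) _

/-- An initial segment of the lexicographic order consists of the first cells in the numbering of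
the grid column by column. -/
theorem sum_run_eq_lexWeight {L : Finset (V ×ₗ V)} (e : V ≃o Fin (t * p))
    (hL : IsLowerSet (L : Set (V ×ₗ V))) :
    ∑ z ∈ L.map ofLex.toEmbedding, (run k p (e z.1) + run k p (e z.2)) =
      lexWeight k p t #L := by
  set c : V ×ₗ V → ℕ := fun z => t * p * e (ofLex z).1 + e (ofLex z).2 with hc
  have hdiv : ∀ z, c z / (t * p) = e (ofLex z).1 := fun z => by
    have h := (e (ofLex z).2).2
    rw [hc, Nat.mul_add_div (by lia), Nat.div_eq_of_lt h, add_zero]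
  have hmod : ∀ z, c z % (t * p) = e (ofLex z).2 := fun z => by
    rw [hc, Nat.mul_add_mod, Nat.mod_eq_of_lt (e (ofLex z).2).2]
  have hinj : c.Injective := fun z w hzw => by
    have h1 := hdiv z
    have h2 := hmod z
    rw [hzw, hdiv] at h1
    rw [hzw, hmod] at h2
    exact ofLex.injective (Prod.ext (rank_injective e h1.symm) (rank_injective e h2.symm))
  have h := sum_eq_sum_range hinj (D := L) (fun z hz j hj => ?_)
    fun j => run k p (j / (t * p)) + run k p (j % (t * p))
  · simp only [hdiv, hmod] at h
    rw [sum_map]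
    exact h
  · have hT : 0 < t * p := by have := (e (ofLex z).2).2; lia
    have hj1 : j / (t * p) ≤ e (ofLex z).1 := (hdiv z) ▸ Nat.div_le_div_right hj.le
    have hj2 := Nat.mod_lt j hT
    refine ⟨toLex (e.symm ⟨j / (t * p), hj1.trans_lt (e (ofLex z).1).2⟩,
      e.symm ⟨j % (t * p), hj2⟩), hL ?_ hz, ?_⟩
    · rw [Prod.Lex.le_iff]
      rcases hj1.lt_or_eq with h | h
      · left
        rw [ofLex_toLex, e.symm_apply_lt]
        exact h
      · right
        rw [ofLex_toLex]
        constructor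
        · rw [e.symm_apply_eq]
          exact Fin.ext h
        · rw [e.symm_apply_le, Fin.le_def, ← hmod z]
          have h1 := Nat.div_add_mod j (t * p)
          have h2 := Nat.div_add_mod (c z) (t * p)
          rw [hdiv] at h2
          rw [h] at h1
          dsimp only
          lia
    · simp [hc, Nat.div_add_mod]

variable [Fintype V]

/-- The column of `A` over `x`. -/
def column (A : Finset (V × V)) (x : V) : Finset V := {y | (x, y) ∈ A}

/-- The row of `A` at height `y`. -/
def row (A : Finset (V × V)) (y : V) : Finset V := {x | (x, y) ∈ A}

theorem mem_column {A : Finset (V × V)} {x y : V} : y ∈ column A x ↔ (x, y) ∈ A := by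
  simp [column]

theorem mem_row {A : Finset (V × V)} {x y : V} : x ∈ row A y ↔ (x, y) ∈ A := by
  simp [row]

theorem sum_eq_sum_column (A : Finset (V × V)) {M : Type*} [AddCommMonoid M] (f : V → V → M) :
    ∑ z ∈ A, f z.1 z.2 = ∑ x, ∑ y ∈ column A x, f x y :=
  sum_finset_product A univ (column A) (by simp [mem_column])

theorem sum_eq_sum_row (A : Finset (V × V)) {M : Type*} [AddCommMonoid M] (f : V → V → M) :
    ∑ z ∈ A, f z.1 z.2 = ∑ y, ∑ x ∈ row A y, f x y :=
  sum_finset_product_right A univ (row A) (by simp [mem_row])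

theorem isLowerSet_column {A : Finset (V × V)} (hA : IsLowerSet (A : Set (V × V))) (x : V) :
    IsLowerSet (column A x : Set V) := by
  intro y z hzy hy
  rw [mem_coe, mem_column] at *
  exact hA (Prod.mk_le_mk.2 ⟨le_rfl, hzy⟩) hy

theorem isLowerSet_row {A : Finset (V × V)} (hA : IsLowerSet (A : Set (V × V))) (y : V) :
    IsLowerSet (row A y : Set V) := by
  intro x z hzx hx
  rw [mem_coe, mem_row] at *
  exact hA (Prod.mk_le_mk.2 ⟨hzx, le_rfl⟩) hx

/-- The weight of a downset is determined by the sizes of its columns and rows. -/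
theorem sum_run_eq {A : Finset (V × V)} (hA : IsLowerSet (A : Set (V × V))) :
    ∑ z ∈ A, (run k p (e z.1) + run k p (e z.2)) =
      ∑ x, runSum k p #(column A x) + ∑ y, runSum k p #(row A y) := by
  rw [sum_add_distrib, add_comm, sum_eq_sum_column A fun _ y => run k p (e y),
    sum_eq_sum_row A fun x _ => run k p (e x)]
  congr 1
  · exact sum_congr rfl fun x _ => sum_run_of_isLowerSet e (isLowerSet_column hA x)
  · exact sum_congr rfl fun y _ => sum_run_of_isLowerSet e (isLowerSet_row hA y)

end Cells

/-! ### Edges of Cartesian products -/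

section Edges

variable {V : Type*}

open scoped Classical in
/-- The number of ordered pairs of adjacent vertices of `A`. -/
noncomputable def adjPairs (G : SimpleGraph V) (A : Finset V) : ℕ :=
  ∑ x ∈ A, ∑ y ∈ A, if G.Adj x y then 1 else 0

theorem adjPairs_eq [Fintype V] (G : SimpleGraph V) (A : Finset V) :
    adjPairs G A = 2 * EdgeIso.inducedEdges G A := by
  classical
  let K : SimpleGraph V :=
    { Adj := fun x y => G.Adj x y ∧ x ∈ A ∧ y ∈ A
      symm := ⟨fun x y h => ⟨h.1.symm, h.2.2, h.2.1⟩⟩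
      loopless := ⟨fun x h => G.loopless.irrefl x h.1⟩ }
  have h1 : EdgeIso.inducedEdges G A = #K.edgeFinset := by
    rw [EdgeIso.inducedEdges, ← Set.ncard_coe_finset]
    congr 1
    ext z
    induction z with
    | _ x y => simp [K]
  rw [h1, ← K.sum_degrees_eq_twice_card_edges, adjPairs]
  have h2 : ∀ x, K.degree x = if x ∈ A then ∑ y ∈ A, if G.Adj x y then 1 else 0 else 0 := by
    intro x
    rw [← K.card_neighborFinset_eq_degree, ← sum_filter, sum_const, smul_eq_mul, mul_one]
    split_ifs with hx
    · congr 1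
      ext y
      simp [K, hx, and_comm]
    · rw [card_eq_zero, eq_empty_iff_forall_notMem]
      intro y
      simp [K, hx]
  simp [h2]

theorem inducedEdges_lexProd [Fintype V] (G : SimpleGraph V) (A : Finset (V ×ₗ V)) :
    EdgeIso.inducedEdges (EdgeIso.lexProd G G) A =
      EdgeIso.inducedEdges (G.boxProd G) (A.map ofLex.toEmbedding) := by
  have h : adjPairs (EdgeIso.lexProd G G) A =
      adjPairs (G.boxProd G) (A.map ofLex.toEmbedding) := by
    simp only [adjPairs, sum_map]
    rfl
  rw [adjPairs_eq, adjPairs_eq] at h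
  lia

open scoped Classical in
/-- Each pair of adjacent vertices is counted once for every set that contains both. -/
theorem sum_adjPairs_eq [Fintype V] [DecidableEq V] (G : SimpleGraph V) {ι : Type*} (s : Finset ι)
    (R : ι → Finset V) :
    ∑ j ∈ s, adjPairs G (R j) =
      ∑ x, ∑ y, if G.Adj x y then #{j ∈ s | x ∈ R j ∧ y ∈ R j} else 0 := by
  have h1 : ∀ j, adjPairs G (R j) =
      ∑ x, ∑ y, if G.Adj x y ∧ x ∈ R j ∧ y ∈ R j then 1 else 0 := by
    intro j
    rw [adjPairs, ← sum_subset (subset_univ (R j)) fun x _ hx => by simp [hx]]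
    refine sum_congr rfl fun x hx => ?_
    rw [← sum_subset (subset_univ (R j)) fun y _ hy => by simp [hy]]
    exact sum_congr rfl fun y hy => by simp [hx, hy]
  simp only [h1]
  rw [sum_comm]
  refine sum_congr rfl fun x _ => ?_
  rw [sum_comm]
  refine sum_congr rfl fun y _ => ?_
  split_ifs with h <;> simp [h]

variable [Fintype V] [LinearOrder V]

theorem adjPairs_boxProd (G : SimpleGraph V) (A : Finset (V × V)) :
    adjPairs (G.boxProd G) A = ∑ x, adjPairs G (column A x) + ∑ y, adjPairs G (row A y) := by
  classical
  have h1 : ∑ z ∈ A, ∑ w ∈ A, (if z.1 = w.1 ∧ G.Adj z.2 w.2 then 1 else 0) =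
      ∑ x, adjPairs G (column A x) := by
    rw [sum_eq_sum_column A fun x y => ∑ w ∈ A, if x = w.1 ∧ G.Adj y w.2 then 1 else 0]
    refine sum_congr rfl fun x _ => sum_congr rfl fun y _ => ?_
    rw [sum_eq_sum_column A fun x' y' => if x = x' ∧ G.Adj y y' then 1 else 0,
      Fintype.sum_eq_single x fun x' hx' => sum_eq_zero fun y' _ => if_neg fun h => hx' h.1.symm]
    simp
  have h2 : ∑ z ∈ A, ∑ w ∈ A, (if z.2 = w.2 ∧ G.Adj z.1 w.1 then 1 else 0) =
      ∑ y, adjPairs G (row A y) := by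
    rw [sum_eq_sum_row A fun x y => ∑ w ∈ A, if y = w.2 ∧ G.Adj x w.1 then 1 else 0]
    refine sum_congr rfl fun y _ => sum_congr rfl fun x _ => ?_
    rw [sum_eq_sum_row A fun x' y' => if y = y' ∧ G.Adj x x' then 1 else 0,
      Fintype.sum_eq_single y fun y' hy' => sum_eq_zero fun x' _ => if_neg fun h => hy' h.1.symm]
    simp
  rw [← h1, ← h2, adjPairs, ← sum_add_distrib]
  refine sum_congr rfl fun z _ => ?_
  rw [← sum_add_distrib]
  refine sum_congr rfl fun w _ => ?_
  rw [SimpleGraph.boxProd_adj]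
  by_cases e1 : z.1 = w.1 <;> by_cases e2 : z.2 = w.2 <;> simp [e1, e2]

/-- Replacing all columns by initial segments of the same sizes does not decrease the number of
horizontal edges. -/
theorem sum_adjPairs_row_le (G : SimpleGraph V) (A : Finset (V × V)) :
    ∑ y, adjPairs G (row A y) ≤
      ∑ j ∈ range (Fintype.card V), adjPairs G {x | j < #(column A x)} := by
  classical
  rw [sum_adjPairs_eq, sum_adjPairs_eq]
  refine sum_le_sum fun x _ => sum_le_sum fun x' _ => ?_
  split_ifs
  · have h1 : univ.filter (fun y => x ∈ row A y ∧ x' ∈ row A y) = column A x ∩ column A x' := by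
      ext y
      simp [mem_row, mem_column]
    have h2 : (range (Fintype.card V)).filter (fun j => x ∈ ({x | j < #(column A x)} : Finset V) ∧
        x' ∈ ({x | j < #(column A x)} : Finset V)) =
        range (min #(column A x) #(column A x')) := by
      ext j
      have := card_le_univ (column A x)
      simp
      lia
    rw [h1, h2, card_range]
    exact le_min (card_le_card inter_subset_left) (card_le_card inter_subset_right)
  · rfl

end Edges

/-! ### Optimality for the product graph and for the grid -/

section Main

variable {V : Type*} [Fintype V] {G : SimpleGraph V} {s p i : ℕ}

theorem coe_runSeq (x : ℕ) : (EdgeIso.runSeq p i x : ℤ) = run (p - i) p x := by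
  unfold EdgeIso.runSeq run
  push_cast
  ring

theorem maxInduced_eq (hG : EdgeIso.HasRunDeltaSequence G s p i) {m : ℕ}
    (hm : m ≤ s * p) : (EdgeIso.maxInduced G m : ℤ) = runSum (p - i) p m := by
  induction m with
  | zero =>
    have : EdgeIso.inducedEdges G ∅ = 0 := by
      have := adjPairs_eq G ∅
      simp only [adjPairs, sum_empty] at this
      lia
    simp [EdgeIso.maxInduced, this, runSum_zero]
  | succ m ih =>
    have h := hG.2 m (by lia)
    rw [EdgeIso.delta, Nat.add_sub_cancel, coe_runSeq, ih (by lia)] at h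
    rw [runSum_succ]
    linarith

theorem adjPairs_le (hG : EdgeIso.HasRunDeltaSequence G s p i) (A : Finset V) :
    (adjPairs G A : ℤ) ≤ 2 * runSum (p - i) p #A := by
  have h1 : EdgeIso.inducedEdges G A ≤ EdgeIso.maxInduced G #A :=
    le_sup (f := EdgeIso.inducedEdges G) (mem_powersetCard.2 ⟨subset_univ _, rfl⟩)
  have h2 := maxInduced_eq hG (m := #A) ((card_le_univ A).trans hG.1.le)
  rw [adjPairs_eq, ← h2]
  exact_mod_cast Nat.mul_le_mul_left 2 h1

variable [LinearOrder V]

theorem adjPairs_of_isLowerSet (hG : EdgeIso.HasRunDeltaSequence G s p i)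
    (hV : EdgeIso.IsOptimalOrder G) {A : Finset V} (hA : IsLowerSet (A : Set V)) :
    (adjPairs G A : ℤ) = 2 * runSum (p - i) p #A := by
  rw [adjPairs_eq, hV A hA, ← maxInduced_eq hG ((card_le_univ A).trans hG.1.le)]
  push_cast
  rfl

theorem admissible (hi : 1 ≤ i) (hip : 2 * i ≤ p) : Admissible (p - i) p :=
  ⟨by lia, by lia, by lia⟩

/-- The edges in the columns of `A` and in its rows are bounded by the two sums in
`sum_runSum_le`. -/
theorem adjPairs_boxProd_le (hi : 1 ≤ i) (hip : 2 * i ≤ p) (hs : 0 < s)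
    (hG : EdgeIso.HasRunDeltaSequence G s p i) (A : Finset (V × V)) :
    (adjPairs (G.boxProd G) A : ℤ) ≤ 2 * lexWeight (p - i) p s #A := by
  have h1 := sum_adjPairs_row_le G A
  have h2 := sum_runSum_le (admissible hi hip) hs (a := fun x => #(column A x)) hG.1
    fun x => (card_le_univ _).trans hG.1.le
  have h3 : #A = ∑ x, #(column A x) := by
    simpa using sum_eq_sum_column A fun _ _ => (1 : ℕ)
  rw [adjPairs_boxProd, h3]
  have h4 := sum_le_sum (s := univ) fun x _ => adjPairs_le hG (column A x)
  have h5 := sum_le_sum (s := range (s * p)) fun j _ =>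
    adjPairs_le hG {x | j < #(column A x)}
  rw [← mul_sum] at h4 h5
  rw [hG.1] at h1
  have h6 : ((∑ y, adjPairs G (row A y) : ℕ) : ℤ) ≤
    (∑ j ∈ range (s * p), adjPairs G {x | j < #(column A x)} : ℕ) := by exact_mod_cast h1
  push_cast at h6 ⊢
  linarith

theorem adjPairs_boxProd_of_isLowerSet (hG : EdgeIso.HasRunDeltaSequence G s p i)
    (hV : EdgeIso.IsOptimalOrder G) {L : Finset (V ×ₗ V)} (hL : IsLowerSet (L : Set (V ×ₗ V))) :
    (adjPairs (G.boxProd G) (L.map ofLex.toEmbedding) : ℤ) = 2 * lexWeight (p - i) p s #L := by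
  have e : V ≃o Fin (s * p) := (Fintype.orderIsoFinOfCardEq V hG.1).symm
  have hL' := isLowerSet_map_ofLex hL
  rw [← sum_run_eq_lexWeight e hL, sum_run_eq e hL', adjPairs_boxProd, mul_add, mul_sum, mul_sum]
  push_cast
  congr 1
  · exact sum_congr rfl fun x _ => adjPairs_of_isLowerSet hG hV (isLowerSet_column hL' x)
  · exact sum_congr rfl fun y _ => adjPairs_of_isLowerSet hG hV (isLowerSet_row hL' y)

theorem isOptimalOrder_lexProd (hi : 1 ≤ i) (hip : 2 * i ≤ p) (hs : 0 < s)
    (hG : EdgeIso.HasRunDeltaSequence G s p i) (hV : EdgeIso.IsOptimalOrder G) :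
    EdgeIso.IsOptimalOrder (EdgeIso.lexProd G G) := by
  intro L hL
  refine le_antisymm
    (le_sup (f := EdgeIso.inducedEdges _) (mem_powersetCard.2 ⟨subset_univ _, rfl⟩))
    (Finset.sup_le fun A hA => ?_)
  have h1 := adjPairs_boxProd_le hi hip hs hG (A.map ofLex.toEmbedding)
  have h2 := adjPairs_boxProd_of_isLowerSet hG hV hL
  rw [card_map, (mem_powersetCard.1 hA).2, ← h2, adjPairs_eq, adjPairs_eq] at h1
  rw [inducedEdges_lexProd, inducedEdges_lexProd]
  have h3 := Nat.cast_le.1 h1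
  lia

theorem weight_le (hi : 1 ≤ i) (hip : 2 * i ≤ p) (hs : 0 < s)
    {B : Finset (Fin (s * p) × Fin (s * p))}
    (hB : IsLowerSet (B : Set (Fin (s * p) × Fin (s * p)))) :
    (EdgeIso.weight i B : ℤ) ≤ lexWeight (p - i) p s #B := by
  have h1 := sum_run_eq (k := p - i) (p := p) (OrderIso.refl _) hB
  have h2 := sum_runSum_le (admissible hi hip) hs (a := fun x => #(column B x)) (Fintype.card_fin _)
    fun x => (card_le_univ _).trans (Fintype.card_fin _).le
  have h3 : #B = ∑ x, #(column B x) := by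
    simpa using sum_eq_sum_column B fun _ _ => (1 : ℕ)
  have h4 : ∀ y, row B y = ({x | (y : ℕ) < #(column B x)} : Finset _) := fun y => by
    ext x
    rw [mem_row, ← mem_column, mem_iff_rank_lt (OrderIso.refl _) (isLowerSet_column hB x)]
    simp
  rw [EdgeIso.weight, h3]
  push_cast
  simp only [coe_runSeq]
  refine le_trans (le_of_eq (h1.trans ?_)) h2
  congr 1
  rw [← Fin.sum_univ_eq_sum_range (fun y => runSum (p - i) p #{x | y < #(column B x)})]
  exact sum_congr rfl fun y _ => by rw [h4]

theorem isMaxWeightDownset (hi : 1 ≤ i) (hip : 2 * i ≤ p) (hs : 0 < s)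
    {L : Finset (Fin (s * p) ×ₗ Fin (s * p))}
    (hL : IsLowerSet (L : Set (Fin (s * p) ×ₗ Fin (s * p)))) :
    EdgeIso.IsMaxWeightDownset i (L.map ofLex.toEmbedding) := by
  refine ⟨isLowerSet_map_ofLex hL, fun B hB hcard => ?_⟩
  have h1 := weight_le hi hip hs hB
  have h2 := sum_run_eq_lexWeight (k := p - i) (OrderIso.refl _) hL
  rw [hcard, card_map, ← h2] at h1
  simp only [OrderIso.refl_apply, ← coe_runSeq] at h1
  unfold EdgeIso.weight at h1 ⊢
  exact_mod_cast h1

end Main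

end RunGrid

theorem mainTheorem1 (s p i : ℕ) (hp : 3 ≤ p) (hs : 2 ≤ s) (hi : 1 ≤ i) (hip : 2 * i ≤ p) :
    (∀ (V : Type*) [Fintype V] [LinearOrder V] (G : SimpleGraph V),
      EdgeIso.HasRunDeltaSequence G s p i → EdgeIso.IsOptimalOrder G →
        EdgeIso.IsOptimalOrder (EdgeIso.lexProd G G)) ∧
    (∀ L : Finset (Fin (s * p) ×ₗ Fin (s * p)),
      IsLowerSet (L : Set (Fin (s * p) ×ₗ Fin (s * p))) →
        EdgeIso.IsMaxWeightDownset i (L.map ofLex.toEmbedding)) :=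
  ⟨fun _ _ _ _ hG hV => RunGrid.isOptimalOrder_lexProd hi hip (by lia) hG hV,
    fun _ hL => RunGrid.isMaxWeightDownset hi hip (by lia) hL⟩
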